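/- Let $(\mathbb K,\partial)$ be a differential field and let $U=\mathbb K[Y;\partial]$ be its ring of differential operators, i.e. the right $\mathbb K$-vector space with basis $1,Y,Y^2,\dots$ and multiplication determined by $xY=Yx+\partial(x)$ for $x\in\mathbb K$. A finite-dimensional differential vector space is a finite-dimensional right $\mathbb K$-vector space $M$ with an additive map $\partial_M$ such that $\partial_M(mx)=\partial_M(m)x+m\,\partial(x)$ (equivalently, a right $U$-module of finite dimension over $\mathbb K$); write $M^*=\mathrm{Hom}_{\mathbb K}(M,\mathbb K)$ and $T_M$ for the ring of endomorphisms of $(M,\partial_M)$. Let $$U^\circ=\Big(\bigoplus_{(M,\partial_M)} M^*\otimes_{T_M}M\Big)\Big/\big\langle \psi\otimes h(x)-\psi h\otimes x \;:\; h:M\to N \text{ a morphism},\ \psi\in N^*,\ x\in M\big\rangle$$ be the finite dual of $U$, with the $\mathbb K$-bimodule structure $x\cdot\overline{\varphi\otimes m}\cdot y=\overline{x\varphi\otimes my}$ and the coring structure $$\Delta_\circ(\overline{\varphi\otimes m})=\sum_i\overline{\varphi\otimes e_i}\otimes_{\mathbb K}\overline{e_i^*\otimes m},\qquad \varepsilon_\circ(\overline{\varphi\otimes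 m})=\varphi(m),$$ where $(e_i)$ is a basis of $M$ with dual basis $(e_i^*)$. For a nonzero $P\in U$ put $M_P=U/PU$, with differential given by right multiplication by $Y$, and let $y_n\in M_P$ be the class of $Y^n$; then $y_0,\dots,y_{\deg P-1}$ is a basis of $M_P$. For sequences $\alpha,\beta\in\mathbb K^{\mathbb N}$ let $(\alpha\cdot\beta)(n)=\sum_{k=0}^n\binom nk\alpha(k)\beta(n-k)$ and $\mathcal N(\alpha)(n)=\alpha(n+1)$, and for $x\in\mathbb K$ let $t(x)=(\partial^n(x))_{n\ge0}$. For $P=\sum_iY^ic_i\in U$ let $\mathcal L_P(\alpha)=\sum_i t(c_i)\cdot\mathcal N^i(\alpha)$, and let $\mathsf{Dlin}(\mathbb K)$ be the set of all $\alpha$ with $\mathcal L_P(\alpha)=0$ for some nonzero $P$; $\mathbb K$ acts on it on the left componentwise and on the right by multiplication with $t(x)$. (1) The vector spaces $M_P^*$, for nonzero $P\in U$, form a directed system of left $U^\circ$-comodules. Here $P\le Q$ means $Q\in PU$, the coaction on $M_P^*$ is $f\mapsto\sum_{i<\deg P}\overline{f\otimes y_i}\otimes_{\mathbb K}y_i^*$,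 and for $Q\in PU$ the transition map $M_P^*\to M_Q^*$ is $f\mapsto f\circ\pi_{P,Q}$ with $\pi_{P,Q}:M_Q\to M_P$ the canonical projection; the transition maps are colinear. The map $f\mapsto(f(y_n))_{n\ge0}$ is a bijection from $M_P^*$ onto the space $\{\alpha:\mathcal L_P(\alpha)=0\}$ of formal solutions. (2) The direct limit of this system in the category of left $U^\circ$-comodules is $U^\circ$, as a comodule over itself via $\Delta_\circ$, with the maps $M_P^*\to U^\circ$, $f\mapsto\overline{f\otimes\bar1}$, as canonical maps; these are injective, colinear and compatible with the transition maps. (3) The map $\overline{\varphi\otimes m}\mapsto(\varphi(\partial_M^n(m)))_{n\ge0}$ is an isomorphism $U^\circ\cong\mathsf{Dlin}(\mathbb K)$ of $\mathbb K$-bimodules and of left $U^\circ$-comodules, where, after the identification $U^\circ\cong\mathsf{Dlin}(\mathbb K)$ in the left tensor factor, the coaction on $\mathsf{Dlin}(\mathbb K)$ is $\alpha\mapsto\sum_{i<\deg P}\mathcal N^i(\alpha)\otimes_{\mathbb K}(y_i^*(y_n))_{n\ge0}$ for any nonzero $P$ with $\mathcal L_P(\alpha)=0$. -/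

import Mathlib

open scoped TensorProduct Differential
open Module (Dual)

set_option linter.unusedSectionVars false
set_option linter.unusedSimpArgs false

universe u v w

namespace DiffRec

noncomputable section

/-! ## Bimodules, corings and left comodules over a field -/

section Comodules

variable (K : Type u) [Field K]

/-- A `K`-bimodule `C`, regarded as a vector space by means of its right action. -/
def RightMod (_K : Type u) (C : Type v) : Type v := C

variable (C : Type v) [AddCommGroup C] [Module K C] [Module Kᵐᵒᵖ C] [SMulCommClass K Kᵐᵒᵖ C]
variable (V : Type w) [AddCommGroup V] [Module K V]

instance : AddCommGroup (RightMod K C) := inferInstanceAs (AddCommGroup C)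

instance : Module K (RightMod K C) :=
  Module.compHom C (RingEquiv.toOpposite K : K ≃+* Kᵐᵒᵖ).toRingHom

/-- The tensor product `C ⊗_K V` of a bimodule and a left vector space: the right action on `C`
is balanced against the action on `V`. -/
def BTensor : Type (max v w) := RightMod K C ⊗[K] V

instance : AddCommGroup (BTensor K C V) := inferInstanceAs (AddCommGroup (RightMod K C ⊗[K] V))

variable {K C V}

/-- The pure tensor `c ⊗ v`. -/
def btmul (c : C) (v : V) : BTensor K C V := TensorProduct.tmul K (M := RightMod K C) c v

/-- A balanced biadditive map on `C × V` induces an additive map on `C ⊗_K V`. -/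
def BTensor.lift {A : Type*} [AddCommGroup A] (F : C →+ V →+ A)
    (hF : ∀ (x : K) (c : C) (v : V), F (MulOpposite.op x • c) v = F c (x • v)) :
    BTensor K C V →+ A :=
  TensorProduct.liftAddHom (R := K) (M := RightMod K C) (N := V) F (fun x c v => hF x c v)

@[simp] lemma BTensor.lift_btmul {A : Type*} [AddCommGroup A] (F : C →+ V →+ A)
    (hF : ∀ (x : K) (c : C) (v : V), F (MulOpposite.op x • c) v = F c (x • v)) (c : C) (v : V) :
    BTensor.lift F hF (btmul c v) = F c v := rfl

lemma btmul_add (c : C) (v v' : V) :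
    (btmul c (v + v') : BTensor K C V) = btmul c v + btmul c v' :=
  TensorProduct.tmul_add (M := RightMod K C) _ _ _

lemma add_btmul (c c' : C) (v : V) :
    (btmul (c + c') v : BTensor K C V) = btmul c v + btmul c' v :=
  TensorProduct.add_tmul (M := RightMod K C) _ _ _

lemma btmul_balanced (x : K) (c : C) (v : V) :
    (btmul (MulOpposite.op x • c) v : BTensor K C V) = btmul c (x • v) :=
  TensorProduct.smul_tmul (R := K) (M := RightMod K C) x c v

lemma BTensor.induction {p : BTensor K C V → Prop} (z : BTensor K C V) (h0 : p 0)
    (ht : ∀ c v, p (btmul c v)) (ha : ∀ a b, p a → p b → p (a + b)) : p z :=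
  TensorProduct.induction_on (motive := p) z h0 ht ha

variable (K C V) in
/-- The pure tensor as a biadditive map. -/
def btmulHom : C →+ V →+ BTensor K C V :=
  AddMonoidHom.mk' (fun c => AddMonoidHom.mk' (fun v => btmul c v) (btmul_add c))
    (fun c c' => by ext v; exact add_btmul c c' v)

@[simp] lemma btmulHom_apply (c : C) (v : V) : btmulHom K C V c v = btmul c v := rfl

lemma btmul_sum {ι : Type*} (s : Finset ι) (c : C) (f : ι → V) :
    (btmul c (∑ i ∈ s, f i) : BTensor K C V) = ∑ i ∈ s, btmul c (f i) :=
  map_sum (btmulHom K C V c) f s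

lemma BTensor.hom_ext {A : Type*} [AddCommGroup A] {f g : BTensor K C V →+ A}
    (h : ∀ c v, f (btmul c v) = g (btmul c v)) : f = g := by
  ext z
  induction z using BTensor.induction with
  | h0 => simp
  | ht c v => exact h c v
  | ha a b ha hb => simp [ha, hb]

/-- Left multiplication by `x` on `C ⊗_K V`, through the left action on `C`. -/
def BTensor.lsmul (x : K) : BTensor K C V →+ BTensor K C V :=
  BTensor.lift ((btmulHom K C V).comp (DistribSMul.toAddMonoidHom C x))
    (fun y c v => by
      change btmul (x • MulOpposite.op y • c) v = btmul (x • c) (y • v)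
      rw [smul_comm, btmul_balanced])

/-- `C ⊗_K V` is a left vector space through the left action on `C`. -/
instance : Module K (BTensor K C V) where
  smul x := BTensor.lsmul x
  one_smul z := by
    change BTensor.lsmul (1 : K) z = AddMonoidHom.id _ z
    congr 1
    exact BTensor.hom_ext fun c v => by simp [BTensor.lsmul]
  mul_smul x y z := by
    change BTensor.lsmul (x * y) z = ((BTensor.lsmul x).comp (BTensor.lsmul y)) z
    congr 1
    exact BTensor.hom_ext fun c v => by simp [BTensor.lsmul, mul_smul]
  smul_zero x := map_zero (BTensor.lsmul x)
  smul_add x := map_add (BTensor.lsmul x)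
  add_smul x y z := by
    change BTensor.lsmul (x + y) z = (BTensor.lsmul x + BTensor.lsmul y : BTensor K C V →+ BTensor K C V) z
    congr 1
    exact BTensor.hom_ext fun c v => by simp [BTensor.lsmul, add_smul]
  zero_smul z := by
    change BTensor.lsmul (0 : K) z = (0 : BTensor K C V →+ BTensor K C V) z
    congr 1
    exact BTensor.hom_ext fun c v => by simp [BTensor.lsmul]

@[simp] lemma smul_btmul (x : K) (c : C) (v : V) :
    x • (btmul c v : BTensor K C V) = btmul (x • c) v := rfl

variable {W : Type*} [AddCommGroup W] [Module K W]

variable (C) in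
/-- `C ⊗_K f` for a linear map `f`. -/
def BTensor.map (f : V →ₗ[K] W) : BTensor K C V →ₗ[K] BTensor K C W :=
  { BTensor.lift (AddMonoidHom.mk' (fun c => (btmulHom K C W c).comp f.toAddMonoidHom)
        (fun c c' => by ext v; simp)) (fun x c v => by simp [btmul_balanced]) with
    map_smul' := fun x z => by
      induction z using BTensor.induction with
      | h0 => simp
      | ht c v => simp
      | ha a b ha hb => rw [smul_add]; simp at ha hb ⊢; rw [ha, hb] }

@[simp] lemma BTensor.map_btmul (f : V →ₗ[K] W) (c : C) (v : V) :
    BTensor.map C f (btmul c v) = btmul c (f v) := rfl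

/-- `c ↦ c ⊗ v` as a left linear map. -/
def btmulRight (v : V) : C →ₗ[K] BTensor K C V where
  toFun c := btmul c v
  map_add' c c' := add_btmul c c' v
  map_smul' _ _ := rfl

@[simp] lemma btmulRight_apply (v : V) (c : C) :
    btmulRight v c = (btmul c v : BTensor K C V) := rfl

variable (C) in
/-- The right action of `x` on `C` as a left linear map. -/
def rightMul (x : K) : C →ₗ[K] C where
  toFun c := MulOpposite.op x • c
  map_add' := smul_add _
  map_smul' y c := (smul_comm y (MulOpposite.op x) c).symm

@[simp] lemma rightMul_apply (x : K) (c : C) : rightMul C x c = MulOpposite.op x • c := rfl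

variable (V) in
/-- For a left and right linear `Δ : C → C ⊗_K C`, the map `Δ ⊗_K V` followed by the
associativity isomorphism `(C ⊗_K C) ⊗_K V ≅ C ⊗_K (C ⊗_K V)`. It sends `c ⊗ v` to
`∑ c₁ ⊗ (c₂ ⊗ v)` if `Δ c = ∑ c₁ ⊗ c₂`. -/
def comulTensor (Δ : C →ₗ[K] BTensor K C C)
    (hΔ : ∀ (x : K) (c : C), Δ (MulOpposite.op x • c) = BTensor.map C (rightMul C x) (Δ c)) :
    BTensor K C V →+ BTensor K C (BTensor K C V) :=
  BTensor.lift
    (AddMonoidHom.mk' (fun c => AddMonoidHom.mk' (fun v => BTensor.map C (btmulRight v) (Δ c))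
        (fun v v' => by
          generalize Δ c = z
          induction z using BTensor.induction with
          | h0 => simp
          | ht c₁ c₂ => simp [btmul_add]
          | ha a b ha hb => simp only [map_add, ha, hb]; abel))
      (fun c c' => by ext v; simp))
    (fun x c v => by
      simp only [AddMonoidHom.mk'_apply, hΔ]
      generalize Δ c = z
      induction z using BTensor.induction with
      | h0 => simp
      | ht c₁ c₂ => simp [btmul_balanced]
      | ha a b ha hb => simp only [map_add, ha, hb])

variable (V) in
/-- For a left and right linear `ε : C → K`, the map `C ⊗_K V → K ⊗_K V ≅ V`,
`c ⊗ v ↦ ε(c) v`. -/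
def counitTensor (ε : C →ₗ[K] K)
    (hε : ∀ (x : K) (c : C), ε (MulOpposite.op x • c) = ε c * x) :
    BTensor K C V →+ V :=
  BTensor.lift
    (AddMonoidHom.mk' (fun c => DistribSMul.toAddMonoidHom V (ε c))
      (fun c c' => by ext v; simp [add_smul]))
    (fun x c v => by simp [hε, mul_smul])

variable (C) in
/-- For a left linear `ε : C → K`, the map `C ⊗_K C → C ⊗_K K ≅ C`, `c ⊗ c' ↦ c ε(c')`. -/
def tensorCounit (ε : C →ₗ[K] K) : BTensor K C C →+ C :=
  BTensor.lift
    (AddMonoidHom.mk' (fun c => AddMonoidHom.mk' (fun c' => MulOpposite.op (ε c') • c)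
        (fun c' c'' => by simp [add_smul]))
      (fun c c' => by ext v; simp))
    (fun x c v => by
      simp only [AddMonoidHom.mk'_apply, map_smul, ← mul_smul, ← MulOpposite.op_mul,
        smul_eq_mul, mul_comm x])

variable (K C) in
/-- A `K`-coring: a coalgebra in the monoidal category of `K`-bimodules. -/
class Coring where
  /-- the comultiplication -/
  comul : C →ₗ[K] BTensor K C C
  comul_right : ∀ (x : K) (c : C),
    comul (MulOpposite.op x • c) = BTensor.map C (rightMul C x) (comul c)
  /-- the counit -/
  counit : C →ₗ[K] K
  counit_right : ∀ (x : K) (c : C), counit (MulOpposite.op x • c) = counit c * x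
  coassoc : ∀ c, comulTensor C comul comul_right (comul c) = BTensor.map C comul (comul c)
  counit_comul : ∀ c, counitTensor C counit counit_right (comul c) = c
  comul_counit : ∀ c, tensorCounit C counit (comul c) = c

/-- A linear map between left comodules is colinear if it commutes with the coactions. -/
def IsColinear (ρ : V →ₗ[K] BTensor K C V) (ρ' : W →ₗ[K] BTensor K C W) (f : V →ₗ[K] W) : Prop :=
  ∀ v, ρ' (f v) = BTensor.map C f (ρ v)

variable [Coring K C]

/-- `ρ : V → C ⊗_K V` is a left coaction of the coring `C` on `V`: it is counital and
coassociative. -/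
structure IsLeftComodule (ρ : V →ₗ[K] BTensor K C V) : Prop where
  counit_coact : ∀ v, counitTensor V (Coring.counit (K := K) (C := C))
    Coring.counit_right (ρ v) = v
  coassoc : ∀ v, comulTensor V (Coring.comul (K := K) (C := C)) Coring.comul_right (ρ v) =
    BTensor.map C ρ (ρ v)

end Comodules

/-! ## The ring of differential operators `U = K[Y; ∂]` -/

section Operators

variable (K : Type u) [Field K]

/-- The ring of differential operators `U = K[Y; ∂]`. As a right `K`-vector space it has the basis
`1, Y, Y², …`: the function `c` stands for the operator `∑ Yⁱ c i`. -/
def DiffOp : Type u := ℕ →₀ K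

namespace DiffOp

instance : AddCommGroup (DiffOp K) := inferInstanceAs (AddCommGroup (ℕ →₀ K))

/-- The right `K`-vector space structure of `U`, written on the left (`K` is commutative):
`x • ∑ Yⁱ cᵢ = ∑ Yⁱ cᵢ x`, which is the product `(∑ Yⁱ cᵢ) x`. -/
instance : Module K (DiffOp K) := inferInstanceAs (Module K (ℕ →₀ K))

variable {K}

/-- The operator `Yⁱ c`. -/
def mono (i : ℕ) (c : K) : DiffOp K := Finsupp.single i c

/-- The coefficient of `Yⁱ`. -/
def coeff (P : DiffOp K) (i : ℕ) : K := (show ℕ →₀ K from P) i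

/-- The operator `Y`. -/
def Y : DiffOp K := mono 1 1

/-- The embedding of `K` into `U`. -/
def C (c : K) : DiffOp K := mono 0 c

/-- The degree of an operator (with value `0` at `0`). -/
def degree (P : DiffOp K) : ℕ := (show ℕ →₀ K from P).support.sup id

lemma mono_add (i : ℕ) (c d : K) : mono i (c + d) = mono i c + mono i d :=
  Finsupp.single_add ..

lemma smul_mono (x : K) (i : ℕ) (c : K) : x • mono i c = mono i (x * c) :=
  Finsupp.smul_single ..

/-- The monomial `Yⁱ c` as an additive map of `c`. -/
def monoHom (i : ℕ) : K →+ DiffOp K := AddMonoidHom.mk' (mono i) (mono_add i)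

@[simp] lemma monoHom_apply (i : ℕ) (c : K) : monoHom i c = mono i c := rfl

lemma hom_ext {A : Type*} [AddCommMonoid A] {f g : DiffOp K →+ A}
    (h : ∀ i c, f (mono i c) = g (mono i c)) : f = g :=
  Finsupp.addHom_ext h

/-- Additive maps out of `U` are determined by arbitrary additive maps on the monomials. -/
def lift {A : Type*} [AddCommMonoid A] (F : ℕ → K →+ A) : DiffOp K →+ A :=
  Finsupp.liftAddHom F

@[simp] lemma lift_mono {A : Type*} [AddCommMonoid A] (F : ℕ → K →+ A) (i : ℕ) (c : K) :
    lift F (mono i c) = F i c :=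
  Finsupp.liftAddHom_apply_single F i c

/-- Right multiplication by `b`. -/
def smulE (b : K) : AddMonoid.End (DiffOp K) := DistribSMul.toAddMonoidHom (DiffOp K) b

@[simp] lemma smulE_apply (b : K) (u : DiffOp K) : smulE b u = b • u := rfl

variable [Differential K]

/-- Right multiplication by `Y`: `(Yⁱ c) Y = Yⁱ⁺¹ c + Yⁱ ∂(c)`, since `c Y = Y c + ∂(c)`. -/
def rmulY : AddMonoid.End (DiffOp K) :=
  lift (A := DiffOp K) fun i => monoHom (i + 1) +
    (monoHom i).comp (Differential.deriv : Derivation ℤ K K).toLinearMap.toAddMonoidHom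

@[simp] lemma rmulY_mono (i : ℕ) (c : K) : rmulY (mono i c) = mono (i + 1) c + mono i c′ :=
  lift_mono (A := DiffOp K) _ i c

/-- Right multiplication: `rmul v u = u v`, that is `u (∑ Yʲ bⱼ) = ∑ ((u Yʲ) bⱼ)`. -/
def rmul : DiffOp K →+ AddMonoid.End (DiffOp K) :=
  lift fun j => AddMonoidHom.mk'
    (fun b => smulE b *
      rmulY ^ j)
    (fun b b' => by
      ext u
      change (b + b') • (rmulY ^ j) u = b • (rmulY ^ j) u + b' • (rmulY ^ j) u
      exact add_smul ..)

instance : Mul (DiffOp K) := ⟨fun u v => rmul v u⟩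

instance : One (DiffOp K) := ⟨mono 0 1⟩

lemma mul_def (u v : DiffOp K) : u * v = rmul v u := rfl

lemma one_def : (1 : DiffOp K) = mono 0 1 := rfl

lemma mul_mono (u : DiffOp K) (j : ℕ) (b : K) :
    u * mono j b = b • rmulY^[j] u := by
  simp [mul_def, rmul]

lemma mul_add' (u v w : DiffOp K) : u * (v + w) = u * v + u * w := by
  simp only [mul_def, map_add]; rfl

lemma add_mul' (u v w : DiffOp K) : (u + v) * w = u * w + v * w := by
  simp only [mul_def, map_add]

lemma rmulY_smul (b : K) (u : DiffOp K) : rmulY (b • u) = b • rmulY u + b′ • u := by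
  have : (AddMonoidHom.mk' (fun u : DiffOp K => rmulY (b • u)) (fun u v => by simp)) =
      AddMonoidHom.mk' (fun u : DiffOp K => b • rmulY u + b′ • u)
        (fun u v => by simp only [map_add, smul_add]; abel) := by
    refine hom_ext fun i c => ?_
    change rmulY (b • mono i c) = b • rmulY (mono i c) + b′ • mono i c
    simp [smul_mono, Derivation.leibniz, mono_add, mul_comm, add_assoc]
  exact DFunLike.congr_fun this u

lemma mul_rmulY (u v : DiffOp K) : u * rmulY v = rmulY (u * v) := by
  have : AddMonoidHom.mk' (fun v => u * rmulY v) (fun v w => by simp [mul_add']) =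
      AddMonoidHom.mk' (fun v => rmulY (u * v)) (fun v w => by simp [mul_add']) := by
    refine hom_ext fun i c => ?_
    change u * rmulY (mono i c) = rmulY (u * mono i c)
    rw [rmulY_mono, mul_add', mul_mono, mul_mono, mul_mono, rmulY_smul,
      Function.iterate_succ_apply']
  exact DFunLike.congr_fun this v

lemma mul_smul' (u v : DiffOp K) (b : K) : u * (b • v) = b • (u * v) := by
  have : AddMonoidHom.mk' (fun v => u * (b • v)) (fun v w => by simp [mul_add']) =
      AddMonoidHom.mk' (fun v => b • (u * v)) (fun v w => by simp [mul_add']) := by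
    refine hom_ext fun i c => ?_
    change u * (b • mono i c) = b • (u * mono i c)
    simp [mul_mono, smul_mono, mul_smul]
  exact DFunLike.congr_fun this v

lemma mul_rmulY_iterate (u v : DiffOp K) (j : ℕ) : u * rmulY^[j] v = rmulY^[j] (u * v) := by
  induction j with
  | zero => rfl
  | succ j ih => rw [Function.iterate_succ_apply', Function.iterate_succ_apply', mul_rmulY, ih]

lemma mul_assoc' (u v w : DiffOp K) : u * v * w = u * (v * w) := by
  have : AddMonoidHom.mk' (fun w => u * v * w) (mul_add' (u * v)) =
      AddMonoidHom.mk' (fun w => u * (v * w)) (fun w x => by simp [mul_add']) := by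
    refine hom_ext fun j b => ?_
    change u * v * mono j b = u * (v * mono j b)
    rw [mul_mono, mul_mono, mul_smul', mul_rmulY_iterate]
  exact DFunLike.congr_fun this w

lemma mono_zero (i : ℕ) : (mono i 0 : DiffOp K) = 0 := Finsupp.single_zero _

lemma rmulY_iterate_one (j : ℕ) : (rmulY^[j] 1 : DiffOp K) = mono j 1 := by
  induction j with
  | zero => rfl
  | succ j ih => simp [Function.iterate_succ_apply', ih, mono_zero]

lemma one_mul' (u : DiffOp K) : 1 * u = u := by
  have : AddMonoidHom.mk' (fun w : DiffOp K => 1 * w) (mul_add' 1) = AddMonoidHom.id _ := by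
    refine hom_ext fun j b => ?_
    change 1 * mono j b = mono j b
    simp [mul_mono, rmulY_iterate_one, smul_mono]
  exact DFunLike.congr_fun this u

/-- `U` is a ring. -/
instance : Ring (DiffOp K) :=
  { (inferInstance : AddCommGroup (DiffOp K)), (inferInstance : Mul (DiffOp K)),
    (inferInstance : One (DiffOp K)) with
    left_distrib := mul_add'
    right_distrib := add_mul'
    zero_mul := fun a => by simp [mul_def]
    mul_zero := fun a => by simp [mul_def]
    mul_assoc := mul_assoc'
    one_mul := one_mul'
    mul_one := fun a => by simp [one_def, mul_mono] }

lemma mul_Y (u : DiffOp K) : u * Y = rmulY u := by simp [Y, mul_mono]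

lemma mul_C (u : DiffOp K) (x : K) : u * C x = x • u := by simp [C, mul_mono]

lemma C_mul_Y (x : K) : C x * Y = Y * C x + C x′ := by
  rw [mul_Y, mul_C]; simp [C, Y, smul_mono]

lemma C_mul_C (x y : K) : C x * C y = C (x * y) := by
  rw [mul_C]; simp [C, smul_mono, mul_comm]

lemma Y_pow (n : ℕ) : (Y : DiffOp K) ^ n = mono n 1 := by
  induction n with
  | zero => rfl
  | succ n ih => rw [pow_succ, ih, mul_Y]; simp; exact mono_zero _

lemma mono_eq (n : ℕ) (c : K) : mono n c = Y ^ n * C c := by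
  rw [mul_C, Y_pow, smul_mono, mul_one]

/-- The principal right ideal `P U`. -/
def rightIdeal (P : DiffOp K) : Submodule K (DiffOp K) :=
  LinearMap.range (M := DiffOp K) (M₂ := DiffOp K)
    (show DiffOp K →ₗ[K] DiffOp K from
    { toFun := fun u => P * u
      map_add' := mul_add P
      map_smul' := fun x u => mul_smul' P u x })

lemma mem_rightIdeal {P Q : DiffOp K} : Q ∈ rightIdeal P ↔ ∃ u, P * u = Q := Iff.rfl

end DiffOp

end Operators

/-! ## Differential modules and the modules `U / P U` -/

section DifferentialModules

variable (K : Type u) [Field K] [Differential K]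

/-- A finite-dimensional differential vector space over `K`, i.e. a right `U`-module of finite
dimension over `K`, with `Y` acting as `der`. Right vector spaces are written on the left. The
Leibniz rule implies that `der` is linear over the constants. -/
structure DiffMod where
  /-- the underlying vector space -/
  carrier : Type u
  [addCommGroup : AddCommGroup carrier]
  [module : Module K carrier]
  [finite : Module.Finite K carrier]
  /-- the differential -/
  der : carrier →+ carrier
  leibniz : ∀ (x : K) (m : carrier), der (x • m) = x • der m + x′ • m

namespace DiffMod

variable {K}

instance : CoeSort (DiffMod K) (Type u) := ⟨carrier⟩

instance (M : DiffMod K) : AddCommGroup M := M.addCommGroup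
instance (M : DiffMod K) : Module K M := M.module
instance (M : DiffMod K) : Module.Finite K M := M.finite

/-- Morphisms of differential vector spaces, i.e. of right `U`-modules. -/
structure Hom (M N : DiffMod K) where
  /-- the underlying linear map -/
  lin : M →ₗ[K] N
  comm : ∀ m, lin (M.der m) = N.der (lin m)

end DiffMod

variable {K}

namespace DiffOp

/-- The quotient `U / P U`. -/
abbrev Quot (P : DiffOp K) : Type u := DiffOp K ⧸ rightIdeal P

/-- The class of an operator in `U / P U`. -/
def cl (P : DiffOp K) : DiffOp K →ₗ[K] Quot P := (rightIdeal P).mkQ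

/-- The differential of `U / P U`: right multiplication by `Y`. -/
def quotDer (P : DiffOp K) : Quot P →+ Quot P :=
  QuotientAddGroup.lift (rightIdeal P).toAddSubgroup
    ((cl P).toAddMonoidHom.comp (AddMonoidHom.mulRight Y)) (by
      rintro _ ⟨u, rfl⟩
      exact (Submodule.Quotient.mk_eq_zero _).2 ⟨u * Y, (mul_assoc P u Y).symm⟩)

@[simp] lemma quotDer_cl (P u : DiffOp K) : quotDer P (cl P u) = cl P (u * Y) := rfl

lemma cl_surjective (P : DiffOp K) : Function.Surjective (cl P) := Submodule.mkQ_surjective _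

lemma cl_self (P : DiffOp K) : cl P P = 0 :=
  (Submodule.Quotient.mk_eq_zero _).2 ⟨1, mul_one P⟩

lemma quotDer_leibniz (P : DiffOp K) (x : K) (m : Quot P) :
    quotDer P (x • m) = x • quotDer P m + x′ • m := by
  obtain ⟨u, rfl⟩ := cl_surjective P m
  rw [← map_smul, quotDer_cl, quotDer_cl, ← map_smul, ← map_smul, ← map_add, mul_Y, mul_Y,
    rmulY_smul]

lemma sum_mono (P : DiffOp K) : P = ∑ i ∈ Finset.range (P.degree + 1), mono i (P.coeff i) := by
  have h : (show ℕ →₀ K from P).sum Finsupp.single = P := Finsupp.sum_single _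
  rw [Finsupp.sum_of_support_subset (s := Finset.range (P.degree + 1))] at h
  · exact h.symm
  · intro i hi
    exact Finset.mem_range.2 (Nat.lt_succ_of_le (Finset.le_sup (f := id) hi))
  · simp

lemma coeff_degree_ne_zero {P : DiffOp K} (hP : P ≠ 0) : P.coeff P.degree ≠ 0 := by
  obtain ⟨i, hi, h⟩ := Finset.exists_mem_eq_sup (show ℕ →₀ K from P).support
    (Finsupp.support_nonempty_iff.2 hP) id
  have : P.degree = i := h
  rw [this]
  exact Finsupp.mem_support_iff.1 hi

lemma mono_eq_smul (i : ℕ) (c : K) : mono i c = c • Y ^ i := by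
  rw [Y_pow, smul_mono, mul_one]

lemma span_quot {P : DiffOp K} (hP : P ≠ 0) :
    Submodule.span K (Set.range fun i : Fin P.degree => cl P (Y ^ (i : ℕ))) = ⊤ := by
  set S := Submodule.span K (Set.range fun i : Fin P.degree => cl P (Y ^ (i : ℕ))) with hS
  have hlt : ∀ i, i < P.degree → cl P (Y ^ i) ∈ S := fun i hi =>
    Submodule.subset_span ⟨⟨i, hi⟩, rfl⟩
  have hd : cl P (Y ^ P.degree) ∈ S := by
    have h := cl_self P
    conv at h => lhs; arg 2; rw [sum_mono P]
    rw [map_sum, Finset.sum_range_succ, mono_eq_smul, map_smul] at h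
    have h2 : P.coeff P.degree • cl P (Y ^ P.degree) ∈ S := by
      rw [eq_neg_of_add_eq_zero_right h]
      refine S.neg_mem (S.sum_mem fun i hi => ?_)
      rw [mono_eq_smul, map_smul]
      exact S.smul_mem _ (hlt i (Finset.mem_range.1 hi))
    exact (S.smul_mem_iff (coeff_degree_ne_zero hP)).1 h2
  have hstab : ∀ m ∈ S, quotDer P m ∈ S := by
    intro m hm
    induction hm using Submodule.span_induction with
    | mem m hm =>
      obtain ⟨i, rfl⟩ := hm
      simp only [quotDer_cl, ← pow_succ]
      rcases (Nat.succ_le_of_lt i.2).lt_or_eq with h | h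
      · exact hlt _ h
      · rw [Nat.succ_eq_add_one] at h; rw [h]; exact hd
    | zero => simp
    | add a b _ _ ha hb => rw [map_add]; exact S.add_mem ha hb
    | smul x m hm h =>
      rw [quotDer_leibniz]
      exact S.add_mem (S.smul_mem _ h) (S.smul_mem _ hm)
  have hall : ∀ n, cl P (Y ^ n) ∈ S := by
    intro n
    induction n with
    | zero =>
      rcases Nat.eq_zero_or_pos P.degree with h | h
      · rw [← h]; exact hd
      · exact hlt 0 h
    | succ n ih => rw [pow_succ, ← quotDer_cl]; exact hstab _ ih
  rw [eq_top_iff]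
  rintro m -
  obtain ⟨u, rfl⟩ := cl_surjective P m
  rw [sum_mono u, map_sum]
  refine S.sum_mem fun i _ => ?_
  rw [mono_eq_smul, map_smul]
  exact S.smul_mem _ (hall i)

/-- For `P ≠ 0` the differential module `M_P = U / P U`. -/
def toMod (P : DiffOp K) (hP : P ≠ 0) : DiffMod K where
  carrier := Quot P
  finite := ⟨(span_quot hP) ▸ Submodule.fg_span (Set.finite_range _)⟩
  der := quotDer P
  leibniz := quotDer_leibniz P

end DiffOp

variable (K) in
/-- The nonzero differential operators, as index set of the directed system. -/
def NzOp : Type u := {P : DiffOp K // P ≠ 0}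

namespace NzOp

/-- `P ≤ Q` means `Q ∈ P U`. -/
instance : Preorder (NzOp K) where
  le P Q := Q.1 ∈ DiffOp.rightIdeal P.1
  le_refl P := ⟨1, mul_one P.1⟩
  le_trans P Q R := by
    rintro ⟨u, hu⟩ ⟨v, hv⟩
    refine ⟨u * v, ?_⟩
    change P.1 * u = Q.1 at hu
    change Q.1 * v = R.1 at hv
    change P.1 * (u * v) = R.1
    rw [← hv, ← hu, mul_assoc]

lemma rightIdeal_le {P Q : NzOp K} (h : P ≤ Q) :
    DiffOp.rightIdeal Q.1 ≤ DiffOp.rightIdeal P.1 := by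
  rintro _ ⟨v, rfl⟩
  obtain ⟨u, hu⟩ := h
  refine ⟨u * v, ?_⟩
  change P.1 * u = Q.1 at hu
  change P.1 * (u * v) = Q.1 * v
  rw [← hu, mul_assoc]

/-- `M_P = U / P U` -/
def M (P : NzOp K) : DiffMod K := P.1.toMod P.2

/-- The class in `M_P` of an operator. -/
def cl (P : NzOp K) : DiffOp K →ₗ[K] P.M := P.1.cl

/-- The canonical projection `π_{P,Q} : M_Q → M_P` for `Q ∈ P U`. -/
def proj {P Q : NzOp K} (h : P ≤ Q) : DiffMod.Hom Q.M P.M where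
  lin := Submodule.factor (rightIdeal_le h)
  comm m := by
    obtain ⟨u, rfl⟩ := DiffOp.cl_surjective Q.1 m
    rfl

/-- The transition map `π_{P,Q}^* : M_P^* → M_Q^*`, `f ↦ f ∘ π_{P,Q}`. -/
def trans {P Q : NzOp K} (h : P ≤ Q) : Dual K P.M →ₗ[K] Dual K Q.M := (proj h).lin.dualMap

@[simp] lemma proj_cl {P Q : NzOp K} (h : P ≤ Q) (u : DiffOp K) :
    (proj h).lin (Q.cl u) = P.cl u := rfl

end NzOp

end DifferentialModules

/-! ## The finite dual `U°` -/

section FiniteDual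

variable (K : Type u) [Field K] [Differential K]

variable {K} in
/-- `M^* ⊗_ℤ M` -/
def DualTensor (M : DiffMod K) : Type u := Dual K M ⊗[ℤ] M

instance (M : DiffMod K) : AddCommGroup (DualTensor M) :=
  inferInstanceAs (AddCommGroup (Dual K M ⊗[ℤ] M))

/-- `K` acts on the factor `M^*`. -/
instance (M : DiffMod K) : Module K (DualTensor M) :=
  inferInstanceAs (Module K (Dual K M ⊗[ℤ] M))

variable {K} in
/-- The pure tensor `ψ ⊗ m` as a biadditive map. -/
def dualTmul (M : DiffMod K) : Dual K M →+ M →+ DualTensor M :=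
  AddMonoidHom.mk' (fun ψ => AddMonoidHom.mk' (fun m => (ψ ⊗ₜ[ℤ] m : Dual K M ⊗[ℤ] M))
      (TensorProduct.tmul_add ψ))
    (fun ψ ψ' => by ext m; exact TensorProduct.add_tmul ψ ψ' m)

/-- The direct sum over all finite-dimensional differential vector spaces `M` of `M^* ⊗_ℤ M`. -/
abbrev PreDual : Type (u + 1) := DirectSum (DiffMod K) DualTensor

variable {K} in
open scoped Classical in
/-- The element `ψ ⊗ m` of the summand belonging to `M`. -/
def preMk (M : DiffMod K) (ψ : Dual K M) (m : M) : PreDual K :=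
  DirectSum.of (DualTensor (K := K)) M (dualTmul M ψ m)

/-- The relations `ψ ⊗ f(x) = (ψ ∘ f) ⊗ x` for all morphisms `f : M → N`. For `M = N` these are
the relations that define `M^* ⊗_{T_M} M` as a quotient of `M^* ⊗_ℤ M`, where `T_M` is the ring of
endomorphisms of `M`. -/
def dualRel : Submodule K (PreDual K) :=
  Submodule.span K {z | ∃ (M N : DiffMod K) (f : DiffMod.Hom M N) (ψ : Dual K N) (x : M),
    z = preMk N ψ (f.lin x) - preMk M (ψ ∘ₗ f.lin) x}

/-- The finite dual `U°`: the quotient of `⨁ M^* ⊗_{T_M} M` by the relations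
`ψ ⊗ f(x) = (ψ ∘ f) ⊗ x` for all morphisms `f : M → N`. The left `K`-action is the one on the
factors `M^*`. -/
def FinDual : Type (u + 1) := PreDual K ⧸ dualRel K

namespace FinDual

instance : AddCommGroup (FinDual K) := inferInstanceAs (AddCommGroup (PreDual K ⧸ dualRel K))

instance : Module K (FinDual K) := inferInstanceAs (Module K (PreDual K ⧸ dualRel K))

variable {K}

/-- The class of `ψ ⊗ m` in `U°`. -/
def mk (M : DiffMod K) (ψ : Dual K M) (m : M) : FinDual K := (dualRel K).mkQ (preMk M ψ m)

lemma mk_add (M : DiffMod K) (ψ : Dual K M) (m m' : M) :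
    mk M ψ (m + m') = mk M ψ m + mk M ψ m' := by
  simp only [mk, preMk, map_add]; rfl

lemma add_mk (M : DiffMod K) (ψ ψ' : Dual K M) (m : M) :
    mk M (ψ + ψ') m = mk M ψ m + mk M ψ' m := by
  simp only [mk, preMk, map_add, AddMonoidHom.add_apply]; rfl

lemma smul_preMk (x : K) (M : DiffMod K) (ψ : Dual K M) (m : M) :
    x • preMk M ψ m = preMk M (x • ψ) m := by
  classical
  rw [preMk, ← DirectSum.lof_eq_of K, ← map_smul]
  rfl

lemma smul_mk (x : K) (M : DiffMod K) (ψ : Dual K M) (m : M) :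
    x • mk M ψ m = mk M (x • ψ) m := by
  rw [mk, mk, ← smul_preMk]; rfl

lemma mk_hom {M N : DiffMod K} (f : DiffMod.Hom M N) (ψ : Dual K N) (x : M) :
    mk N ψ (f.lin x) = mk M (ψ ∘ₗ f.lin) x :=
  (Submodule.Quotient.eq _).2 (Submodule.subset_span ⟨M, N, f, ψ, x, rfl⟩)

lemma induction {p : FinDual K → Prop} (z : FinDual K) (h0 : p 0)
    (hm : ∀ M ψ m, p (mk M ψ m)) (ha : ∀ a b, p a → p b → p (a + b)) : p z := by
  classical
  obtain ⟨z, rfl⟩ := (dualRel K).mkQ_surjective z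
  induction z using DirectSum.induction_on with
  | zero => exact h0
  | of M t =>
    refine TensorProduct.induction_on (motive := fun t : DualTensor M => p ((dualRel K).mkQ
      (DirectSum.of (DualTensor (K := K)) M t))) t ?_ (hm M)
        fun (a b : DualTensor M) ha' hb => ?_
    · change p ((dualRel K).mkQ (DirectSum.of (DualTensor (K := K)) M (0 : DualTensor M)))
      rw [map_zero]; exact h0
    · change p ((dualRel K).mkQ (DirectSum.of (DualTensor (K := K)) M
        (HAdd.hAdd (α := DualTensor M) (β := DualTensor M) a b)))
      rw [map_add, map_add]; exact ha _ _ ha' hb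
  | add a b ha' hb => rw [map_add]; exact ha _ _ ha' hb

lemma hom_ext {A : Type*} [AddCommGroup A] {f g : FinDual K →+ A}
    (h : ∀ M ψ m, f (mk M ψ m) = g (mk M ψ m)) : f = g := by
  ext z
  induction z using FinDual.induction with
  | h0 => simp
  | hm M ψ m => exact h M ψ m
  | ha a b ha hb => rw [map_add, map_add, ha, hb]

/-- Biadditive maps on `M^* × M` as additive maps on `M^* ⊗_ℤ M`. -/
def dualTensorLift {A : Type*} [AddCommGroup A] (M : DiffMod K) (F : Dual K M →+ M →+ A) :
    DualTensor M →+ A :=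
  TensorProduct.liftAddHom F (fun r ψ m => by simp)

open scoped Classical in
/-- The additive map out of the direct sum given by biadditive maps. -/
def preLift {A : Type*} [AddCommGroup A] (F : ∀ M : DiffMod K, Dual K M →+ M →+ A) :
    PreDual K →+ A :=
  DirectSum.toAddMonoid fun M => dualTensorLift M (F M)

@[simp] lemma preLift_preMk {A : Type*} [AddCommGroup A] (F : ∀ M : DiffMod K, Dual K M →+ M →+ A)
    (M : DiffMod K) (ψ : Dual K M) (m : M) : preLift F (preMk M ψ m) = F M ψ m := by
  classical
  exact DirectSum.toAddMonoid_of (fun M => dualTensorLift M (F M)) M (dualTmul M ψ m)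

/-- Biadditive maps on all `M^* × M` that are compatible with morphisms induce an additive map
on `U°`. -/
def lift {A : Type*} [AddCommGroup A] (F : ∀ M : DiffMod K, Dual K M →+ M →+ A)
    (hF : ∀ (M N : DiffMod K) (f : DiffMod.Hom M N) (ψ : Dual K N) (x : M),
      F N ψ (f.lin x) = F M (ψ ∘ₗ f.lin) x) : FinDual K →+ A :=
  QuotientAddGroup.lift (dualRel K).toAddSubgroup (preLift F) (by
    intro z hz
    change preLift F z = 0
    replace hz : z ∈ dualRel K := hz
    induction hz using Submodule.closure_induction with
    | zero => simp
    | add a b _ _ ha hb => rw [map_add, ha, hb, add_zero]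
    | smul_mem r z hz =>
      obtain ⟨M, N, f, ψ, x, rfl⟩ := hz
      rw [smul_sub, smul_preMk, smul_preMk, map_sub, preLift_preMk, preLift_preMk, hF,
        LinearMap.smul_comp, sub_self])

@[simp] lemma lift_mk {A : Type*} [AddCommGroup A] (F : ∀ M : DiffMod K, Dual K M →+ M →+ A)
    (hF : ∀ (M N : DiffMod K) (f : DiffMod.Hom M N) (ψ : Dual K N) (x : M),
      F N ψ (f.lin x) = F M (ψ ∘ₗ f.lin) x) (M : DiffMod K) (ψ : Dual K M) (m : M) :
    lift F hF (mk M ψ m) = F M ψ m :=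
  preLift_preMk F M ψ m

/-- The class of `ψ ⊗ m` as a biadditive map. -/
def mkHom (M : DiffMod K) : Dual K M →+ M →+ FinDual K :=
  AddMonoidHom.mk' (fun ψ => AddMonoidHom.mk' (mk M ψ) (mk_add M ψ))
    (fun ψ ψ' => by ext m; exact add_mk M ψ ψ' m)

@[simp] lemma mkHom_apply (M : DiffMod K) (ψ : Dual K M) (m : M) : mkHom M ψ m = mk M ψ m := rfl

/-- The right action of `x`, which is the one on the factors `M`. -/
def rsmul (x : K) : FinDual K →+ FinDual K :=
  lift (fun M => AddMonoidHom.mk' (fun ψ => (mkHom M ψ).comp (DistribSMul.toAddMonoidHom M x))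
    (fun ψ ψ' => by ext m; simp)) (fun M N f ψ m => by
      change mk N ψ (x • f.lin m) = mk M (ψ ∘ₗ f.lin) (x • m)
      rw [← map_smul, mk_hom])

@[simp] lemma rsmul_mk (x : K) (M : DiffMod K) (ψ : Dual K M) (m : M) :
    rsmul x (mk M ψ m) = mk M ψ (x • m) := lift_mk _ _ M ψ m

/-- The right `K`-action on `U°`: `(ψ ⊗ m) x = ψ ⊗ (m x)`. -/
instance : Module Kᵐᵒᵖ (FinDual K) where
  smul x := rsmul x.unop
  one_smul z := by
    change rsmul (1 : K) z = AddMonoidHom.id _ z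
    congr 1
    exact hom_ext fun M ψ m => by simp
  mul_smul x y z := by
    change rsmul (y.unop * x.unop) z = ((rsmul x.unop).comp (rsmul y.unop)) z
    congr 1
    exact hom_ext fun M ψ m => by simp [← mul_smul, mul_comm]
  smul_zero x := map_zero (rsmul x.unop)
  smul_add x := map_add (rsmul x.unop)
  add_smul x y z := by
    change rsmul (x.unop + y.unop) z = (rsmul x.unop + rsmul y.unop : FinDual K →+ FinDual K) z
    congr 1
    exact hom_ext fun M ψ m => by simp [add_smul, mk_add]
  zero_smul z := by
    change rsmul (0 : K) z = (0 : FinDual K →+ FinDual K) z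
    congr 1
    exact hom_ext fun M ψ m => by simpa using map_zero (mkHom M ψ)

@[simp] lemma op_smul_mk (x : K) (M : DiffMod K) (ψ : Dual K M) (m : M) :
    MulOpposite.op x • mk M ψ m = mk M ψ (x • m) := rsmul_mk x M ψ m

instance : SMulCommClass K Kᵐᵒᵖ (FinDual K) where
  smul_comm x y z := by
    obtain ⟨y, rfl⟩ := MulOpposite.op_surjective y
    induction z using FinDual.induction with
    | h0 => simp
    | hm M ψ m => simp [smul_mk]
    | ha a b ha hb => simp only [smul_add, ha, hb]

/-- `m ↦ ψ ⊗ m` for variable `ψ`, as a left linear map `M^* → U°`. -/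
def mkLeft (M : DiffMod K) (m : M) : Dual K M →ₗ[K] FinDual K where
  toFun ψ := mk M ψ m
  map_add' ψ ψ' := add_mk M ψ ψ' m
  map_smul' x ψ := (smul_mk x M ψ m).symm

@[simp] lemma mkLeft_apply (M : DiffMod K) (m : M) (ψ : Dual K M) :
    mkLeft M m ψ = mk M ψ m := rfl

/-- Independence of the dual basis, and its naturality. -/
lemma sum_dualBasis {M N : Type*} [AddCommGroup M] [Module K M] [AddCommGroup N] [Module K N]
    {ι κ A : Type*} [Fintype ι] [Fintype κ] [AddCommGroup A] (b : Module.Basis ι K M)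
    (b' : Module.Basis κ K N) (h : M →ₗ[K] N) (F : N →+ Dual K M →+ A)
    (hF : ∀ (x : K) n g, F (x • n) g = F n (x • g)) :
    ∑ i, F (h (b i)) (b.coord i) = ∑ j, F (b' j) (b'.coord j ∘ₗ h) := by
  have h1 : ∀ i, F (h (b i)) (b.coord i) =
      ∑ j, F (b' j) (b'.coord j (h (b i)) • b.coord i) := by
    intro i
    conv_lhs => rw [← b'.sum_repr (h (b i))]
    simp only [map_sum, AddMonoidHom.finsetSum_apply, hF]
    rfl
  have h2 : ∀ g : Dual K M, g = ∑ i, g (b i) • b.coord i := fun g => by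
    refine b.ext fun k => ?_
    classical
    simp [Finsupp.single_apply]
  simp_rw [h1]
  rw [Finset.sum_comm]
  refine Finset.sum_congr rfl fun j _ => ?_
  rw [← map_sum]
  congr 1
  exact (h2 (b'.coord j ∘ₗ h)).symm

/-- The left coaction `f ↦ ∑ (f ⊗ eᵢ) ⊗ eᵢ^*` of `U°` on `M^*`, for a basis `eᵢ` of `M`. -/
def coact (M : DiffMod K) : Dual K M →ₗ[K] BTensor K (FinDual K) (Dual K M) where
  toFun f := ∑ i, btmul (mk M f (Module.finBasis K M i)) ((Module.finBasis K M).coord i)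
  map_add' f g := by simp only [add_mk, add_btmul, Finset.sum_add_distrib]
  map_smul' x f := by simp only [← smul_mk, ← smul_btmul, Finset.smul_sum, RingHom.id_apply]

lemma coact_apply (M : DiffMod K) (f : Dual K M) : coact M f =
    ∑ i, btmul (mk M f (Module.finBasis K M i)) ((Module.finBasis K M).coord i) := rfl

/-- The coaction may be computed in any basis. -/
lemma coact_eq (M : DiffMod K) {ι : Type*} [Fintype ι] (b : Module.Basis ι K M) (f : Dual K M) :
    coact M f = ∑ i, btmul (mk M f (b i)) (b.coord i) :=
  sum_dualBasis (Module.finBasis K M) b LinearMap.id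
    (AddMonoidHom.comp (btmulHom K (FinDual K) (Dual K M)) (mkHom M f))
    (fun x n g => by simp [← op_smul_mk, btmul_balanced])

/-- Morphisms of differential modules induce colinear maps of the duals. -/
lemma coact_hom {M N : DiffMod K} (h : DiffMod.Hom M N) (f : Dual K N) :
    coact M (f ∘ₗ h.lin) = BTensor.map (FinDual K) h.lin.dualMap (coact N f) := by
  have := sum_dualBasis (Module.finBasis K M) (Module.finBasis K N) h.lin
    (AddMonoidHom.comp (btmulHom K (FinDual K) (Dual K M)) (mkHom N f))
    (fun x n g => by simp [← op_smul_mk, btmul_balanced])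
  simp only [AddMonoidHom.comp_apply, mkHom_apply, btmulHom_apply, mk_hom] at this
  rw [coact_apply, this, coact_apply, map_sum]
  rfl

lemma map_mkLeft_add (M : DiffMod K) (m m' : M) (z : BTensor K (FinDual K) (Dual K M)) :
    BTensor.map (FinDual K) (mkLeft M (m + m')) z =
      BTensor.map (FinDual K) (mkLeft M m) z + BTensor.map (FinDual K) (mkLeft M m') z := by
  induction z using BTensor.induction with
  | h0 => simp
  | ht c v => simp [mk_add, btmul_add]
  | ha a b ha hb => simp only [map_add, ha, hb]; abel

/-- The comultiplication of `U°` on one summand. -/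
def comulSummand (M : DiffMod K) : Dual K M →+ M →+ BTensor K (FinDual K) (FinDual K) :=
  AddMonoidHom.mk' (fun ψ => AddMonoidHom.mk'
      (fun m => BTensor.map (FinDual K) (mkLeft M m) (coact M ψ))
      (fun m m' => map_mkLeft_add M m m' _))
    (fun ψ ψ' => by ext m; simp)

lemma comulSummand_apply (M : DiffMod K) (ψ : Dual K M) (m : M) :
    comulSummand M ψ m = BTensor.map (FinDual K) (mkLeft M m) (coact M ψ) := rfl

/-- The comultiplication of `U°` as an additive map. -/
def comulAdd : FinDual K →+ BTensor K (FinDual K) (FinDual K) :=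
  lift comulSummand (fun M N f ψ x => by
    rw [comulSummand_apply, comulSummand_apply, coact_hom]
    generalize coact N ψ = z
    induction z using BTensor.induction with
    | h0 => simp
    | ht c v => simp [mk_hom, LinearMap.dualMap_apply']
    | ha a b ha hb => simp only [map_add, ha, hb])

lemma comulAdd_mk (M : DiffMod K) (ψ : Dual K M) (m : M) :
    comulAdd (mk M ψ m) = BTensor.map (FinDual K) (mkLeft M m) (coact M ψ) := lift_mk _ _ M ψ m

/-- The comultiplication `ψ ⊗ m ↦ ∑ (ψ ⊗ eᵢ) ⊗ (eᵢ^* ⊗ m)` of `U°`, for a basis `eᵢ` of `M`. -/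
def comul : FinDual K →ₗ[K] BTensor K (FinDual K) (FinDual K) where
  toFun := comulAdd
  map_add' := map_add comulAdd
  map_smul' x z := by
    rw [RingHom.id_apply]
    induction z using FinDual.induction with
    | h0 => simp
    | hm M ψ m => rw [smul_mk, comulAdd_mk, comulAdd_mk, map_smul, map_smul]
    | ha a b ha hb => rw [smul_add, map_add, ha, hb, map_add, smul_add]

lemma comul_mk (M : DiffMod K) (ψ : Dual K M) (m : M) :
    comul (mk M ψ m) = BTensor.map (FinDual K) (mkLeft M m) (coact M ψ) := comulAdd_mk M ψ m

/-- The counit of `U°` as an additive map. -/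
def counitAdd : FinDual K →+ K :=
  lift (fun M => AddMonoidHom.mk' (fun ψ => ψ.toAddMonoidHom) (fun ψ ψ' => by ext m; simp))
    (fun M N f ψ x => rfl)

lemma counitAdd_mk (M : DiffMod K) (ψ : Dual K M) (m : M) : counitAdd (mk M ψ m) = ψ m :=
  lift_mk _ _ M ψ m

/-- The counit `ψ ⊗ m ↦ ψ(m)` of `U°`. -/
def counit : FinDual K →ₗ[K] K where
  toFun := counitAdd
  map_add' := map_add counitAdd
  map_smul' x z := by
    rw [RingHom.id_apply]
    induction z using FinDual.induction with
    | h0 => simp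
    | hm M ψ m => rw [smul_mk, counitAdd_mk, counitAdd_mk]; rfl
    | ha a b ha hb => rw [smul_add, map_add, ha, hb, map_add, smul_add]

lemma counit_mk (M : DiffMod K) (ψ : Dual K M) (m : M) : counit (mk M ψ m) = ψ m :=
  counitAdd_mk M ψ m

/-- `U°` is a `K`-coring. -/
instance : Coring K (FinDual K) where
  comul := comul
  comul_right x c := by
    induction c using FinDual.induction with
    | h0 => simp
    | hm M ψ m => simp [comul_mk, coact_apply]
    | ha a b ha hb => simp only [smul_add, map_add, ha, hb]
  counit := counit
  counit_right x c := by
    induction c using FinDual.induction with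
    | h0 => simp
    | hm M ψ m => simp [counit_mk, mul_comm]
    | ha a b ha hb => simp only [smul_add, map_add, ha, hb, add_mul]
  coassoc c := by
    induction c using FinDual.induction with
    | h0 => simp
    | hm M ψ m =>
      simp only [comul_mk, coact_apply, map_sum, BTensor.map_btmul, mkLeft_apply, comulTensor,
        BTensor.lift_btmul, AddMonoidHom.mk'_apply, btmulRight_apply, btmul_sum]
      rw [Finset.sum_comm]
    | ha a b ha hb => simp only [map_add, ha, hb]
  counit_comul c := by
    induction c using FinDual.induction with
    | h0 => simp
    | hm M ψ m =>
      simp only [comul_mk, coact_apply, map_sum, BTensor.map_btmul, mkLeft_apply, counitTensor,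
        BTensor.lift_btmul, AddMonoidHom.mk'_apply, counit_mk, DistribSMul.toAddMonoidHom_apply]
      simp_rw [← mkLeft_apply, ← map_smul, ← map_sum]
      congr 1
      exact (Module.finBasis K M).ext fun k => by classical simp [Finsupp.single_apply]
    | ha a b ha hb => simp only [map_add, ha, hb]
  comul_counit c := by
    induction c using FinDual.induction with
    | h0 => simp
    | hm M ψ m =>
      simp only [comul_mk, coact_apply, map_sum, BTensor.map_btmul, mkLeft_apply, tensorCounit,
        BTensor.lift_btmul, AddMonoidHom.mk'_apply, counit_mk, op_smul_mk]
      simp_rw [← mkHom_apply, ← map_sum]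
      congr 1
      exact (Module.finBasis K M).sum_repr m
    | ha a b ha hb => simp only [map_add, ha, hb]

end FinDual

end FiniteDual

/-! ## Differentially recursive sequences -/

section Sequences

variable {K : Type u} [Field K] [Differential K]

/-- The Hurwitz product of sequences. -/
def hurwitz (α β : ℕ → K) (n : ℕ) : K :=
  ∑ ij ∈ Finset.HasAntidiagonal.antidiagonal n, (n.choose ij.1 : K) * (α ij.1 * β ij.2)

/-- The Hurwitz expansion `t(x) = (x, ∂x, ∂²x, …)`. -/
def hurwitzExp (x : K) (n : ℕ) : K := (fun y : K => y′)^[n] x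

/-- The shift operator on sequences. -/
def shift (α : ℕ → K) (n : ℕ) : K := α (n + 1)

/-- For `P = ∑ Yⁱ cᵢ` the operator `𝓛_P = ∑ t(cᵢ) Nⁱ` on sequences, with `N` the shift. -/
def seqOp (P : DiffOp K) (α : ℕ → K) : ℕ → K :=
  ∑ i ∈ Finset.range (P.degree + 1), hurwitz (hurwitzExp (P.coeff i)) (shift^[i] α)

/-- The right linear functional `f_α : U → K` with `f_α(Yⁿ) = α n`. -/
def seqFun (α : ℕ → K) : DiffOp K →ₗ[K] K := Finsupp.linearCombination K α

lemma seqFun_mono (α : ℕ → K) (i : ℕ) (c : K) : seqFun α (DiffOp.mono i c) = c * α i :=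
  Finsupp.linearCombination_single K c i

lemma seqFun_add (α β : ℕ → K) (u : DiffOp K) : seqFun (α + β) u = seqFun α u + seqFun β u := by
  have : (seqFun (α + β)).toAddMonoidHom = (seqFun α).toAddMonoidHom + (seqFun β).toAddMonoidHom :=
    DiffOp.hom_ext fun i c => by
      change seqFun _ (DiffOp.mono i c) = seqFun _ (DiffOp.mono i c) + seqFun _ (DiffOp.mono i c)
      simp [seqFun_mono, mul_add]
  exact DFunLike.congr_fun this u

lemma seqFun_smul (x : K) (α : ℕ → K) (u : DiffOp K) : seqFun (x • α) u = x * seqFun α u := by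
  have : (seqFun (x • α)).toAddMonoidHom = (x • seqFun α).toAddMonoidHom :=
    DiffOp.hom_ext fun i c => by
      change seqFun _ (DiffOp.mono i c) = x * seqFun _ (DiffOp.mono i c)
      simp [seqFun_mono, mul_left_comm]
  exact DFunLike.congr_fun this u

lemma shift_iterate (α : ℕ → K) (i n : ℕ) : (shift^[i] α) n = α (n + i) := by
  induction i generalizing n with
  | zero => rfl
  | succ i ih =>
    rw [Function.iterate_succ_apply', shift, ih]
    congr 1
    omega

lemma seqFun_mono_mul (α : ℕ → K) (i n : ℕ) (c : K) :
    seqFun α (DiffOp.mono i c * DiffOp.Y ^ n) = hurwitz (hurwitzExp c) (shift^[i] α) n := by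
  induction n generalizing i c with
  | zero => simp [hurwitz, hurwitzExp, seqFun_mono, shift_iterate]
  | succ n ih =>
    rw [pow_succ', ← mul_assoc, DiffOp.mul_Y, DiffOp.rmulY_mono, add_mul, map_add, ih, ih]
    unfold hurwitz
    rw [Finset.sum_antidiagonal_choose_succ_mul (fun a b => hurwitzExp c a * (shift^[i] α) b)]
    congr 1
    · refine Finset.sum_congr rfl fun ij _ => ?_
      simp only [shift_iterate]
      congr 3
      omega
    · refine Finset.sum_congr rfl fun ij hij => ?_
      rw [← Finset.HasAntidiagonal.mem_antidiagonal.1 hij, Nat.choose_symm_add]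
      rfl

lemma seqOp_apply (P : DiffOp K) (α : ℕ → K) (n : ℕ) :
    seqOp P α n = seqFun α (P * DiffOp.Y ^ n) := by
  conv_rhs => rw [DiffOp.sum_mono P, Finset.sum_mul, map_sum]
  simp only [seqFun_mono_mul, seqOp, Finset.sum_apply]

lemma seqOp_eq_zero_iff (P : DiffOp K) (α : ℕ → K) :
    seqOp P α = 0 ↔ ∀ u, seqFun α (P * u) = 0 := by
  constructor
  · intro h u
    rw [DiffOp.sum_mono u, Finset.mul_sum, map_sum]
    refine Finset.sum_eq_zero fun i _ => ?_
    rw [DiffOp.mono_eq_smul, DiffOp.mul_smul', map_smul, ← seqOp_apply, h]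
    simp
  · intro h
    ext n
    rw [seqOp_apply, h]
    rfl

/-- Two nonzero operators have a common right multiple. -/
lemma exists_common (P Q : DiffOp K) (hP : P ≠ 0) (hQ : Q ≠ 0) :
    ∃ R : DiffOp K, R ≠ 0 ∧ R ∈ P.rightIdeal ∧ R ∈ Q.rightIdeal := by
  by_contra! hcon
  have h1 : Module.Finite K P.Quot := (P.toMod hP).finite
  have h2 : Module.Finite K Q.Quot := (Q.toMod hQ).finite
  have hinj : Function.Injective (P.cl.prod Q.cl) := by
    rw [← LinearMap.ker_eq_bot, LinearMap.ker_eq_bot']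
    intro R hR
    by_contra h0
    obtain ⟨ha, hb⟩ := Prod.mk.inj hR
    exact hcon R h0 ((Submodule.Quotient.mk_eq_zero _).1 ha) ((Submodule.Quotient.mk_eq_zero _).1 hb)
  have : Module.Finite K (DiffOp K) := Module.Finite.of_injective _ hinj
  have h3 : Module.Finite K (ℕ →₀ K) := this
  have := Module.Finite.finite_basis (Finsupp.basisSingleOne (R := K) (ι := ℕ))
  exact not_finite ℕ

variable (K) in
/-- The space of differentially recursive sequences, i.e. of the sequences annihilated by
`∑ t(cᵢ) Nⁱ` for some nonzero `∑ Yⁱ cᵢ`. Its left vector space structure is the componentwise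
one. -/
def Dlin : Submodule K (ℕ → K) where
  carrier := {α | ∃ P : DiffOp K, P ≠ 0 ∧ seqOp P α = 0}
  zero_mem' := ⟨1, by
    intro h
    have h2 := seqFun_mono (fun _ => (1 : K)) 0 1
    rw [← DiffOp.one_def, h, map_zero, one_mul] at h2
    exact one_ne_zero h2.symm, by
    rw [seqOp_eq_zero_iff]
    intro u
    simpa using seqFun_smul (0 : K) 0 (1 * u)⟩
  add_mem' := by
    rintro α β ⟨P, hP, ha⟩ ⟨Q, hQ, hb⟩
    obtain ⟨R, hR, ⟨u, hu⟩, ⟨v, hv⟩⟩ := exists_common P Q hP hQ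
    change P * u = R at hu
    change Q * v = R at hv
    rw [seqOp_eq_zero_iff] at ha hb
    refine ⟨R, hR, (seqOp_eq_zero_iff _ _).2 fun w => ?_⟩
    rw [seqFun_add]
    nth_rewrite 1 [← hu]
    rw [← hv, mul_assoc, mul_assoc, ha, hb, add_zero]
  smul_mem' := by
    rintro x α ⟨P, hP, ha⟩
    rw [seqOp_eq_zero_iff] at ha
    refine ⟨P, hP, (seqOp_eq_zero_iff _ _).2 fun w => ?_⟩
    rw [seqFun_smul, ha, mul_zero]

lemma mem_Dlin (α : ℕ → K) : α ∈ Dlin K ↔ ∃ P : DiffOp K, P ≠ 0 ∧ seqOp P α = 0 := Iff.rfl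

end Sequences

section Comparison

variable {K : Type u} [Field K] [Differential K]

/-- The iterated differential as an additive map. -/
def DiffMod.derPow (M : DiffMod K) (n : ℕ) : M →+ M :=
  AddMonoidHom.mk' (M.der^[n]) (fun a b => iterate_map_add M.der n a b)

lemma DiffMod.Hom.derPow {M N : DiffMod K} (f : DiffMod.Hom M N) (n : ℕ) (x : M) :
    f.lin (M.derPow n x) = N.derPow n (f.lin x) := by
  change f.lin (M.der^[n] x) = N.der^[n] (f.lin x)
  induction n with
  | zero => rfl
  | succ n ih => rw [Function.iterate_succ_apply', Function.iterate_succ_apply', f.comm, ih]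

/-- The map `ψ ⊗ m ↦ (ψ(∂ⁿ m))_n` from `U°` to sequences, as an additive map. -/
def toSeqAdd : FinDual K →+ (ℕ → K) :=
  FinDual.lift (fun M => AddMonoidHom.mk'
      (fun ψ => AddMonoidHom.mk' (fun m n => ψ (M.derPow n m)) (fun m m' => by ext n; simp))
      (fun ψ ψ' => by ext m n; simp))
    (fun M N f ψ x => by
      ext n
      change ψ (N.derPow n (f.lin x)) = ψ (f.lin (M.derPow n x))
      rw [f.derPow])

lemma toSeqAdd_mk (M : DiffMod K) (ψ : Dual K M) (m : M) (n : ℕ) :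
    toSeqAdd (FinDual.mk M ψ m) n = ψ (M.der^[n] m) :=
  congrFun (FinDual.lift_mk _ _ M ψ m) n

/-- The canonical map `ψ ⊗ m ↦ (ψ(∂ⁿ m))_n` from `U°` to sequences. -/
def toSeq : FinDual K →ₗ[K] (ℕ → K) where
  toFun := toSeqAdd
  map_add' := map_add toSeqAdd
  map_smul' x z := by
    rw [RingHom.id_apply]
    induction z using FinDual.induction with
    | h0 => simp
    | hm M ψ m =>
      ext n
      rw [FinDual.smul_mk, Pi.smul_apply, toSeqAdd_mk, toSeqAdd_mk]
      rfl
    | ha a b ha hb => rw [smul_add, map_add, ha, hb, map_add, smul_add]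

lemma toSeq_mk (M : DiffMod K) (ψ : Dual K M) (m : M) (n : ℕ) :
    toSeq (FinDual.mk M ψ m) n = ψ (M.der^[n] m) := toSeqAdd_mk M ψ m n

/-- The canonical map `ψ_P : M_P^* → U°`, `f ↦ f ⊗ 1`. -/
def NzOp.incl (P : NzOp K) : Dual K P.M →ₗ[K] FinDual K := FinDual.mkLeft P.M (P.cl 1)

end Comparison

end

end DiffRec

open DiffRec

/-! Everything rests on reading a sequence `α` as the right linear functional `seqFun α` on `U` with
`Yⁿ ↦ α n`. Since the value of `seqOp P α` at `n` is `seqFun α (P Yⁿ)`, the equation `seqOp P α = 0`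
says that this functional vanishes on `P U`, i.e. that it descends to `M_P`. So functionals on `M_P`
and formal solutions are the same thing (`NzOp.seqFun_toSeq_incl`, `NzOp.exists_toSeq_incl_eq`). The
sequence of `f` is also the image of `f ⊗ 1` under `toSeq`, hence `incl` is injective.

The images of the `M_P^*` exhaust `U°`. As `U` has infinite dimension, a vector `m` of a
finite-dimensional `M` is killed by some nonzero `P`, so a morphism `M_P → M` sends the class of `1`
to `m`, and the defining relations turn `ψ ⊗ m` into an element of the image of `M_P^*`. Sums are
collected over a common right multiple (`FinDual.exists_incl`). A directed union of injective images
is a direct limit of vector spaces; it is one of comodules because colinearity can be tested on each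
image.

It follows that `toSeq` is injective, being so on every `M_P^*`, and that its image is the union of
all solution spaces, which is `Dlin K`. The coaction on `Dlin K` is the one transported from `U°`.
In the basis `yᵢ` of `M_P` its left factors are the `f ⊗ yᵢ`, whose sequences are the shifts of that
of `f`. That the `yᵢ` with `i < deg P` are independent is a degree argument: degrees add in products
(`DiffOp.coeff_mul_degree`). -/

namespace DiffRec

noncomputable section

/-! ### Naturality of the structure maps and transport of coactions -/

section ComoduleTransport

variable {K : Type u} [Field K] {C : Type v} [AddCommGroup C] [Module K C] [Module Kᵐᵒᵖ C]
  [SMulCommClass K Kᵐᵒᵖ C] {V : Type*} [AddCommGroup V] [Module K V]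
  {W : Type*} [AddCommGroup W] [Module K W] {X : Type*} [AddCommGroup X] [Module K X]

lemma BTensor.map_comp_apply (g : W →ₗ[K] X) (f : V →ₗ[K] W) (z : BTensor K C V) :
    BTensor.map C (g ∘ₗ f) z = BTensor.map C g (BTensor.map C f z) := by
  induction z using BTensor.induction with
  | h0 => simp
  | ht c v => simp
  | ha a b ha hb => simp only [map_add, ha, hb]

lemma counitTensor_map (ε : C →ₗ[K] K)
    (hε : ∀ (x : K) (c : C), ε (MulOpposite.op x • c) = ε c * x) (f : V →ₗ[K] W)
    (z : BTensor K C V) :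
    counitTensor W ε hε (BTensor.map C f z) = f (counitTensor V ε hε z) := by
  induction z using BTensor.induction with
  | h0 => simp
  | ht c v => simp [counitTensor]
  | ha a b ha hb => simp only [map_add, ha, hb]

/-- Only the factor `C` is touched by `Δ`, so a linear map on the other factor passes through.
Together with `counitTensor_map` this carries the comodule axioms across an isomorphism. -/
lemma comulTensor_map (Δ : C →ₗ[K] BTensor K C C)
    (hΔ : ∀ (x : K) (c : C), Δ (MulOpposite.op x • c) = BTensor.map C (rightMul C x) (Δ c))
    (f : V →ₗ[K] W) (z : BTensor K C V) :
    comulTensor W Δ hΔ (BTensor.map C f z) =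
      BTensor.map C (BTensor.map C f) (comulTensor V Δ hΔ z) := by
  induction z using BTensor.induction with
  | h0 => simp
  | ht c v =>
    simp only [BTensor.map_btmul, comulTensor, BTensor.lift_btmul, AddMonoidHom.mk'_apply]
    rw [← BTensor.map_comp_apply]
    rfl
  | ha a b ha hb => simp only [map_add, ha, hb]

/-- The coaction transported along a linear equivalence. -/
def coactTransport (ρ : V →ₗ[K] BTensor K C V) (e : V ≃ₗ[K] W) : W →ₗ[K] BTensor K C W :=
  BTensor.map C e.toLinearMap ∘ₗ ρ ∘ₗ e.symm.toLinearMap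

lemma isColinear_coactTransport (ρ : V →ₗ[K] BTensor K C V) (e : V ≃ₗ[K] W) :
    IsColinear ρ (coactTransport ρ e) e.toLinearMap := fun v => by
  simp [coactTransport]

lemma IsLeftComodule.transport [Coring K C] {ρ : V →ₗ[K] BTensor K C V} (h : IsLeftComodule ρ)
    (e : V ≃ₗ[K] W) : IsLeftComodule (coactTransport ρ e) where
  counit_coact w := by
    obtain ⟨v, rfl⟩ := e.surjective w
    have := isColinear_coactTransport ρ e v
    simp only [LinearEquiv.coe_coe] at this
    rw [this, counitTensor_map, h.counit_coact]
    rfl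
  coassoc w := by
    obtain ⟨v, rfl⟩ := e.surjective w
    have := isColinear_coactTransport ρ e v
    simp only [LinearEquiv.coe_coe] at this
    rw [this, comulTensor_map, h.coassoc, ← BTensor.map_comp_apply, ← BTensor.map_comp_apply]
    -- Both sides are now images of `ρ v`; what remains is the colinearity of `e` as an identity of
    -- linear maps on `V`.
    congr 2
    ext v
    exact (isColinear_coactTransport ρ e v).symm

end ComoduleTransport

/-! ### Degrees in `U` and the basis of `M_P` -/

section Degree

variable {K : Type u} [Field K]

namespace DiffOp

lemma coeff_add (u v : DiffOp K) (n : ℕ) : (u + v).coeff n = u.coeff n + v.coeff n := rfl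

lemma coeff_smul (x : K) (u : DiffOp K) (n : ℕ) : (x • u).coeff n = x * u.coeff n := rfl

lemma coeff_mono (i n : ℕ) (c : K) : (mono i c).coeff n = if i = n then c else 0 :=
  Finsupp.single_apply

/-- The coefficient as an additive map. -/
def coeffHom (n : ℕ) : DiffOp K →+ K := AddMonoidHom.mk' (fun u => u.coeff n)
  (fun u v => coeff_add u v n)

lemma coeff_sum {ι : Type*} (s : Finset ι) (f : ι → DiffOp K) (n : ℕ) :
    (∑ i ∈ s, f i).coeff n = ∑ i ∈ s, (f i).coeff n := map_sum (coeffHom n) f s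

lemma coeff_eq_zero_of_degree_lt {u : DiffOp K} {n : ℕ} (h : u.degree < n) : u.coeff n = 0 := by
  by_contra h0
  exact absurd (Finset.le_sup (f := id) (Finsupp.mem_support_iff.2 h0)) (not_le.2 h)

variable [Differential K]

lemma coeff_rmulY_succ (u : DiffOp K) (n : ℕ) :
    (rmulY u).coeff (n + 1) = u.coeff n + (u.coeff (n + 1))′ := by
  have : (coeffHom (n + 1)).comp rmulY = coeffHom (K := K) n +
      (Differential.deriv : Derivation ℤ K K).toLinearMap.toAddMonoidHom.comp
        (coeffHom (n + 1)) := by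
    refine hom_ext fun i c => ?_
    change (rmulY (mono i c)).coeff (n + 1) =
      (mono i c).coeff n + (((mono i c).coeff (n + 1))′)
    rw [rmulY_mono, coeff_add, coeff_mono, coeff_mono, coeff_mono, coeff_mono]
    by_cases h : i = n + 1 <;> simp [h]
  exact DFunLike.congr_fun this u

/-- In `c Y = Y c + ∂(c)` the derivative stays one degree lower, so the leading coefficient moves up
unchanged. The vanishing above the top is carried along because the new top coefficient also
receives the derivative of the old coefficient in that degree. -/
lemma coeff_rmulY_iterate (u : DiffOp K) (j : ℕ) :
    (∀ n, u.degree + j < n → (rmulY^[j] u).coeff n = 0) ∧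
      (rmulY^[j] u).coeff (u.degree + j) = u.coeff u.degree := by
  induction j with
  | zero => exact ⟨fun n h => coeff_eq_zero_of_degree_lt h, rfl⟩
  | succ j ih =>
    simp only [Function.iterate_succ_apply']
    constructor
    · intro n hn
      obtain ⟨n, rfl⟩ : ∃ k, n = k + 1 := ⟨n - 1, by omega⟩
      rw [coeff_rmulY_succ, ih.1 n (by omega), ih.1 (n + 1) (by omega)]
      simp
    · rw [← add_assoc, coeff_rmulY_succ, ih.2, ih.1 _ (by omega)]
      simp

/-- The leading coefficient of a product. -/
lemma coeff_mul_degree (P u : DiffOp K) :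
    (P * u).coeff (P.degree + u.degree) = u.coeff u.degree * P.coeff P.degree := by
  -- Expands `u` as a factor only and leaves `u.degree` in the index intact.
  have h := congrArg (fun v => (P * v).coeff (P.degree + u.degree)) (sum_mono u)
  refine h.trans ?_
  -- Only the top monomial of `u` can reach the degree `P.degree + u.degree`.
  rw [Finset.mul_sum, coeff_sum, Finset.sum_range_succ, Finset.sum_eq_zero, zero_add]
  · rw [mul_mono, coeff_smul, (coeff_rmulY_iterate P _).2]
  · intro i hi
    rw [mul_mono, coeff_smul, (coeff_rmulY_iterate P i).1, mul_zero]
    have := Finset.mem_range.1 hi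
    omega

/-- For `u ≠ 0` the product `P u` has a nonzero coefficient in degree `deg P + deg u`, which is at
least `deg P`. -/
lemma eq_zero_of_mem_rightIdeal {P R : DiffOp K} (hP : P ≠ 0) (hR : R ∈ P.rightIdeal)
    (h : ∀ n, P.degree ≤ n → R.coeff n = 0) : R = 0 := by
  obtain ⟨u, rfl⟩ := mem_rightIdeal.1 hR
  by_cases hu : u = 0
  · rw [hu, mul_zero]
  · have h1 := h (P.degree + u.degree) (by omega)
    rw [coeff_mul_degree] at h1
    exact absurd h1 (mul_ne_zero (coeff_degree_ne_zero hu) (coeff_degree_ne_zero hP))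

/-- A linear relation lifts to an operator in `P U` without terms of degree `deg P` or more, and
such an operator is zero. -/
lemma linearIndependent_cl {P : DiffOp K} (hP : P ≠ 0) :
    LinearIndependent K fun i : Fin P.degree => cl P (Y ^ (i : ℕ)) := by
  rw [Fintype.linearIndependent_iff]
  intro g hg i
  have h0 : cl P (∑ j : Fin P.degree, mono (j : ℕ) (g j)) = 0 := by
    rw [map_sum, ← hg]
    refine Finset.sum_congr rfl fun j _ => ?_
    rw [mono_eq_smul, map_smul]
  have h1 := eq_zero_of_mem_rightIdeal hP ((Submodule.Quotient.mk_eq_zero _).1 h0) fun n hn => by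
    rw [coeff_sum]
    refine Finset.sum_eq_zero fun j _ => ?_
    rw [coeff_mono, if_neg (by omega)]
  have h2 := congrArg (fun u => coeff u (i : ℕ)) h1
  simp only [coeff_sum, coeff_mono, Fin.val_inj, Finset.sum_ite_eq', Finset.mem_univ,
    if_true] at h2
  exact h2

end DiffOp

variable [Differential K]

/-- The basis `y₀, …, y_{deg P - 1}` of `M_P`. -/
def NzOp.basis (P : NzOp K) : Module.Basis (Fin P.1.degree) K P.M :=
  Module.Basis.mk (M := P.M) (v := fun i => P.cl (DiffOp.Y ^ (i : ℕ)))
    (DiffOp.linearIndependent_cl P.2) (DiffOp.span_quot P.2).ge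

lemma NzOp.basis_apply (P : NzOp K) (i : Fin P.1.degree) :
    P.basis i = P.cl (DiffOp.Y ^ (i : ℕ)) :=
  Module.Basis.mk_apply (M := P.M) _ _ i

end Degree

/-! ### The duals of the `M_P` as spaces of formal solutions -/

section FormalSolutions

variable {K : Type u} [Field K] [Differential K]

instance : Nonempty (NzOp K) := ⟨⟨1, fun h => by
  -- `1 ≠ 0` in `U`, since the functional of the constant sequence `1` takes the value `1` there.
  have h2 := seqFun_mono (K := K) (fun _ => (1 : K)) 0 1
  rw [← DiffOp.one_def, h, map_zero, one_mul] at h2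
  exact one_ne_zero h2.symm⟩⟩

instance : IsDirectedOrder (NzOp K) where
  directed P Q := by
    obtain ⟨R, hR, h1, h2⟩ := exists_common P.1 Q.1 P.2 Q.2
    exact ⟨⟨R, hR⟩, h1, h2⟩

namespace NzOp

lemma cl_surjective (P : NzOp K) : Function.Surjective P.cl := DiffOp.cl_surjective P.1

lemma der_cl (P : NzOp K) (u : DiffOp K) : P.M.der (P.cl u) = P.cl (u * DiffOp.Y) := rfl

lemma der_iterate_cl (P : NzOp K) (u : DiffOp K) (n : ℕ) :
    P.M.der^[n] (P.cl u) = P.cl (u * DiffOp.Y ^ n) := by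
  induction n with
  | zero => simp
  | succ n ih => rw [Function.iterate_succ_apply', ih, der_cl, mul_assoc, pow_succ]

/-- Starting from `yᵢ` instead of `y₀` shifts the sequence by `i` places; this produces the `Nⁱ` in
the coaction on sequences. -/
lemma toSeq_mk_cl (P : NzOp K) (f : Dual K P.M) (i n : ℕ) :
    toSeq (FinDual.mk P.M f (P.cl (DiffOp.Y ^ i))) n = f (P.cl (DiffOp.Y ^ (n + i))) := by
  rw [toSeq_mk, der_iterate_cl, ← pow_add, add_comm]

lemma toSeq_incl (P : NzOp K) (f : Dual K P.M) (n : ℕ) :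
    toSeq (P.incl f) n = f (P.cl (DiffOp.Y ^ n)) := by
  have := P.toSeq_mk_cl f 0 n
  rwa [pow_zero] at this

/-- Both sides are linear in `u` and agree on the powers of `Y`. The sequence thus recovers `f`
pulled back to `U`, hence `f` itself. -/
lemma seqFun_toSeq_incl (P : NzOp K) (f : Dual K P.M) (u : DiffOp K) :
    seqFun (toSeq (P.incl f)) u = f (P.cl u) := by
  rw [DiffOp.sum_mono u]
  simp only [map_sum]
  refine Finset.sum_congr rfl fun i _ => ?_
  rw [seqFun_mono, toSeq_incl, DiffOp.mono_eq_smul, map_smul, map_smul, smul_eq_mul]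

lemma toSeq_incl_injective (P : NzOp K) :
    Function.Injective fun f : Dual K P.M => toSeq (P.incl f) := by
  intro f g h
  refine LinearMap.ext fun m => ?_
  obtain ⟨u, rfl⟩ := P.cl_surjective m
  rw [← seqFun_toSeq_incl, ← seqFun_toSeq_incl]
  exact congrArg (fun α => seqFun α u) h

lemma incl_injective (P : NzOp K) : Function.Injective P.incl := fun _ _ h =>
  P.toSeq_incl_injective (congrArg toSeq h)

lemma seqOp_toSeq_incl (P : NzOp K) (f : Dual K P.M) : seqOp P.1 (toSeq (P.incl f)) = 0 := by
  rw [seqOp_eq_zero_iff]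
  intro u
  rw [seqFun_toSeq_incl]
  have : P.cl (P.1 * u) = 0 := (Submodule.Quotient.mk_eq_zero _).2 ⟨u, rfl⟩
  rw [this, map_zero]

/-- The functional `seqFun α` kills `P U`, and the one that it induces on the quotient is the
required `f`. -/
lemma exists_toSeq_incl_eq (P : NzOp K) {α : ℕ → K} (h : seqOp P.1 α = 0) :
    ∃ f : Dual K P.M, toSeq (P.incl f) = α := by
  rw [seqOp_eq_zero_iff] at h
  have hle : DiffOp.rightIdeal P.1 ≤ LinearMap.ker (seqFun α) := by
    rintro _ ⟨u, rfl⟩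
    exact h u
  refine ⟨(DiffOp.rightIdeal P.1).liftQ (seqFun α) hle, funext fun n => ?_⟩
  refine (toSeq_incl P _ n).trans ?_
  change seqFun α (DiffOp.Y ^ n) = α n
  rw [DiffOp.Y_pow, seqFun_mono, one_mul]

/-- This is the defining relation of `U°` for the projection `M_Q → M_P`, which preserves the class
of `1`. -/
lemma incl_comp_trans {P Q : NzOp K} (h : P ≤ Q) : Q.incl ∘ₗ trans h = P.incl :=
  LinearMap.ext fun f => (FinDual.mk_hom (proj h) f (Q.cl 1)).symm

lemma incl_trans {P Q : NzOp K} (h : P ≤ Q) (f : Dual K P.M) :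
    Q.incl (trans h f) = P.incl f := LinearMap.congr_fun (incl_comp_trans h) f

/-- The comultiplication on a summand is the coaction on `M^*` followed by `- ⊗ m`; for `m` the
class of `1` this is colinearity. -/
lemma isColinear_incl (P : NzOp K) :
    IsColinear (FinDual.coact P.M) (Coring.comul (K := K) (C := FinDual K)) P.incl := fun f =>
  FinDual.comul_mk P.M f (P.cl 1)

lemma isColinear_trans {P Q : NzOp K} (h : P ≤ Q) :
    IsColinear (FinDual.coact P.M) (FinDual.coact Q.M) (trans h) :=
  FinDual.coact_hom (proj h)

instance directedSystem_dual :
    DirectedSystem (fun P : NzOp K => Dual K P.M) (fun _ _ h => trans h) where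
  map_self P f := by
    refine LinearMap.ext fun m => ?_
    obtain ⟨u, rfl⟩ := P.cl_surjective m
    rfl
  map_map R Q P h h' f := by
    refine LinearMap.ext fun (m : R.M) => ?_
    obtain ⟨u, rfl⟩ := R.cl_surjective m
    rfl

end NzOp

/-! ### Cyclic submodules: `U°` is the union of the images of the `M_P^*` -/

/-- The `K`-linear map `U → M`, `u ↦ m u`. -/
def DiffMod.act (M : DiffMod K) (m : M) : DiffOp K →ₗ[K] M :=
  Finsupp.linearCombination K fun i => M.der^[i] m

lemma DiffMod.act_mono (M : DiffMod K) (m : M) (i : ℕ) (c : K) :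
    M.act m (DiffOp.mono i c) = c • M.der^[i] m :=
  Finsupp.linearCombination_single K c i

lemma DiffMod.act_mul_Y (M : DiffMod K) (m : M) (u : DiffOp K) :
    M.act m (u * DiffOp.Y) = M.der (M.act m u) := by
  rw [DiffOp.mul_Y]
  have : (M.act m).toAddMonoidHom.comp DiffOp.rmulY = M.der.comp (M.act m).toAddMonoidHom := by
    refine DiffOp.hom_ext fun i c => ?_
    change M.act m (DiffOp.rmulY (DiffOp.mono i c)) = M.der (M.act m (DiffOp.mono i c))
    rw [DiffOp.rmulY_mono, map_add, act_mono, act_mono, act_mono, M.leibniz,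
      Function.iterate_succ_apply']
  exact DFunLike.congr_fun this u

/-- Annihilators are right ideals: `m P Yⁿ` is the `n`-th derivative of `m P = 0`, and scalars on
the right do no harm. -/
lemma DiffMod.act_mul_eq_zero (M : DiffMod K) (m : M) {P : DiffOp K} (h : M.act m P = 0)
    (u : DiffOp K) : M.act m (P * u) = 0 := by
  have hY : ∀ n, M.act m (P * DiffOp.Y ^ n) = 0 := by
    intro n
    induction n with
    | zero => simpa using h
    | succ n ih => rw [pow_succ, ← mul_assoc, act_mul_Y, ih, map_zero]
  rw [DiffOp.sum_mono u, Finset.mul_sum, map_sum]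
  refine Finset.sum_eq_zero fun i _ => ?_
  rw [DiffOp.mono_eq_smul, DiffOp.mul_smul', map_smul, hY, smul_zero]

/-- Otherwise `u ↦ m u` would embed `U`, with its infinite basis of powers of `Y`, into the
finite-dimensional `M`. -/
lemma DiffMod.exists_act_eq_zero (M : DiffMod K) (m : M) : ∃ P : NzOp K, M.act m P.1 = 0 := by
  by_contra! hcon
  have hinj : Function.Injective (M.act m) := by
    rw [← LinearMap.ker_eq_bot, LinearMap.ker_eq_bot']
    intro R hR
    by_contra h0
    exact hcon ⟨R, h0⟩ hR
  have h3 : Module.Finite K (ℕ →₀ K) := Module.Finite.of_injective (M.act m) hinj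
  have := Module.Finite.finite_basis (Finsupp.basisSingleOne (R := K) (ι := ℕ))
  exact not_finite ℕ

/-- The morphism `M_P → M` that maps the class of `1` to an element `m` annihilated by `P`. -/
def DiffMod.homOfAct (M : DiffMod K) (m : M) (P : NzOp K) (h : M.act m P.1 = 0) :
    DiffMod.Hom P.M M where
  lin := (DiffOp.rightIdeal P.1).liftQ (M.act m) (by
    rintro _ ⟨u, rfl⟩
    exact M.act_mul_eq_zero m h u)
  comm x := by
    obtain ⟨u, rfl⟩ := P.cl_surjective x
    exact M.act_mul_Y m u

lemma DiffMod.homOfAct_one (M : DiffMod K) (m : M) (P : NzOp K) (h : M.act m P.1 = 0) :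
    (M.homOfAct m P h).lin (P.cl 1) = m :=
  (M.act_mono m 0 1).trans (one_smul K m)

/-- Every element of `U°` comes from some `M_P^*`. -/
lemma FinDual.exists_incl (z : FinDual K) : ∃ (P : NzOp K) (f : Dual K P.M), P.incl f = z := by
  induction z using FinDual.induction with
  | h0 => exact ⟨Classical.arbitrary _, 0, map_zero _⟩
  | hm M ψ m =>
    obtain ⟨P, hP⟩ := M.exists_act_eq_zero m
    refine ⟨P, ψ ∘ₗ (M.homOfAct m P hP).lin, ?_⟩
    have := FinDual.mk_hom (M.homOfAct m P hP) ψ (P.cl 1)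
    rw [M.homOfAct_one] at this
    exact this.symm
  | ha a b ha hb =>
    obtain ⟨P, f, rfl⟩ := ha
    obtain ⟨Q, g, rfl⟩ := hb
    -- A common right multiple `R` lets both summands be represented in the single space `M_R^*`.
    obtain ⟨R, h1, h2⟩ := exists_ge_ge P Q
    exact ⟨R, NzOp.trans h1 f + NzOp.trans h2 g, by
      rw [map_add, NzOp.incl_trans, NzOp.incl_trans]⟩

/-! ### The bimodule isomorphism with differentially recursive sequences -/

lemma toSeq_injective : Function.Injective (toSeq (K := K)) := by
  rw [← LinearMap.ker_eq_bot, LinearMap.ker_eq_bot']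
  intro z hz
  obtain ⟨P, f, rfl⟩ := z.exists_incl
  have : f = 0 := P.toSeq_incl_injective (by simpa using hz)
  rw [this, map_zero]

lemma toSeq_mem_Dlin (z : FinDual K) : toSeq z ∈ Dlin K := by
  obtain ⟨P, f, rfl⟩ := z.exists_incl
  exact ⟨P.1, P.2, P.seqOp_toSeq_incl f⟩

/-- The isomorphism between `U°` and the space of differentially recursive sequences. -/
def finDualEquivDlin : FinDual K ≃ₗ[K] Dlin K :=
  LinearEquiv.ofBijective (toSeq.codRestrict (Dlin K) toSeq_mem_Dlin)
    ⟨fun _ _ h => toSeq_injective (congrArg Subtype.val h), fun α => by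
      obtain ⟨P, hP, hα⟩ := α.2
      obtain ⟨f, hf⟩ := NzOp.exists_toSeq_incl_eq ⟨P, hP⟩ hα
      exact ⟨_, Subtype.ext hf⟩⟩

@[simp] lemma coe_finDualEquivDlin (z : FinDual K) :
    (finDualEquivDlin z : ℕ → K) = toSeq z := rfl

lemma hurwitz_comm (α β : ℕ → K) : hurwitz α β = hurwitz β α := by
  ext n
  unfold hurwitz
  rw [← Finset.Nat.sum_antidiagonal_swap]
  refine Finset.sum_congr rfl fun ij hij => ?_
  rw [← Finset.HasAntidiagonal.mem_antidiagonal.1 hij, Prod.fst_swap, Prod.snd_swap,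
    Nat.choose_symm_add, mul_comm (α _)]

/-- For `z = f ⊗ 1` both sides at `n` are `f` of the class of `x Yⁿ`: the right action replaces `1`
by `x`, and moving `x` past `Yⁿ` yields the Hurwitz product with `t(x)`. -/
lemma toSeq_op_smul (x : K) (z : FinDual K) :
    toSeq (MulOpposite.op x • z) = hurwitz (toSeq z) (hurwitzExp x) := by
  obtain ⟨P, f, rfl⟩ := z.exists_incl
  ext n
  have h1 := seqFun_mono_mul (toSeq (P.incl f)) 0 n x
  rw [Function.iterate_zero, id, P.seqFun_toSeq_incl] at h1
  rw [hurwitz_comm, ← h1]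
  change toSeq (MulOpposite.op x • FinDual.mk P.M f (P.cl 1)) n = _
  rw [FinDual.op_smul_mk, ← map_smul, DiffOp.one_def, DiffOp.smul_mono, mul_one, toSeq_mk,
    P.der_iterate_cl]

end FormalSolutions

/-! ### Comodule structures and the universal property -/

section Coactions

variable {K : Type u} [Field K] [Differential K]

lemma FinDual.isLeftComodule_coact (M : DiffMod K) : IsLeftComodule (FinDual.coact M) where
  counit_coact f := by
    simp only [FinDual.coact_apply, map_sum, counitTensor, BTensor.lift_btmul,
      AddMonoidHom.mk'_apply, DistribSMul.toAddMonoidHom_apply]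
    refine (Module.finBasis K M).ext fun k => ?_
    classical
    change (∑ i, FinDual.counit (FinDual.mk M f (Module.finBasis K M i)) •
      (Module.finBasis K M).coord i) _ = _
    simp [FinDual.counit_mk, Finsupp.single_apply]
  coassoc f := by
    change comulTensor _ FinDual.comul _ _ = _
    simp only [FinDual.coact_apply, map_sum, BTensor.map_btmul, comulTensor,
      BTensor.lift_btmul, AddMonoidHom.mk'_apply, FinDual.comul_mk, FinDual.mkLeft_apply,
      btmulRight_apply, btmul_sum]
    -- Both sides are the double sum of `(f ⊗ eᵢ) ⊗ ((eᵢ^* ⊗ eⱼ) ⊗ eⱼ^*)`, in opposite orders of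
    -- summation.
    rw [Finset.sum_comm]

lemma FinDual.isLeftComodule_comul :
    IsLeftComodule (Coring.comul : FinDual K →ₗ[K] BTensor K (FinDual K) (FinDual K)) where
  counit_coact := Coring.counit_comul
  coassoc := Coring.coassoc

variable {V : Type v} [AddCommGroup V] [Module K V]

/-- Two representatives of one element of `U°` already coincide in `M_R^*` for any common upper
bound `R`, by injectivity of `R.incl`. This makes `FinDual.desc` independent of choices. -/
lemma NzOp.eq_of_incl_eq (σ : ∀ P : NzOp K, Dual K P.M →ₗ[K] V)
    (hσ : ∀ (P Q : NzOp K) (h : P ≤ Q), σ Q ∘ₗ NzOp.trans h = σ P) {P Q : NzOp K}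
    {f : Dual K P.M} {g : Dual K Q.M} (h : P.incl f = Q.incl g) : σ P f = σ Q g := by
  obtain ⟨R, h1, h2⟩ := exists_ge_ge P Q
  rw [← hσ P R h1, ← hσ Q R h2, LinearMap.comp_apply, LinearMap.comp_apply]
  congr 1
  apply R.incl_injective
  rw [incl_trans, incl_trans, h]

/-- The linear map out of `U°` given by a compatible family of linear maps on the `M_P^*`. -/
def FinDual.desc (σ : ∀ P : NzOp K, Dual K P.M →ₗ[K] V)
    (hσ : ∀ (P Q : NzOp K) (h : P ≤ Q), σ Q ∘ₗ NzOp.trans h = σ P) : FinDual K →ₗ[K] V where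
  toFun z := σ z.exists_incl.choose z.exists_incl.choose_spec.choose
  map_add' a b := by
    -- The representatives chosen for `a`, `b` and `a + b` may belong to different operators. Those
    -- of `a` and `b` are added over `R`, and the sum is compared with that of `a + b` inside `U°`.
    obtain ⟨R, h1, h2⟩ := exists_ge_ge a.exists_incl.choose b.exists_incl.choose
    rw [← hσ _ R h1, ← hσ _ R h2, LinearMap.comp_apply, LinearMap.comp_apply, ← map_add]
    apply NzOp.eq_of_incl_eq σ hσ
    rw [map_add, NzOp.incl_trans, NzOp.incl_trans, a.exists_incl.choose_spec.choose_spec,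
      b.exists_incl.choose_spec.choose_spec, (a + b).exists_incl.choose_spec.choose_spec]
  map_smul' x a := by
    rw [RingHom.id_apply, ← map_smul]
    apply NzOp.eq_of_incl_eq σ hσ
    rw [map_smul, a.exists_incl.choose_spec.choose_spec,
      (x • a).exists_incl.choose_spec.choose_spec]

lemma FinDual.desc_incl (σ : ∀ P : NzOp K, Dual K P.M →ₗ[K] V)
    (hσ : ∀ (P Q : NzOp K) (h : P ≤ Q), σ Q ∘ₗ NzOp.trans h = σ P) (P : NzOp K)
    (f : Dual K P.M) : FinDual.desc σ hσ (P.incl f) = σ P f :=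
  NzOp.eq_of_incl_eq σ hσ (P.incl f).exists_incl.choose_spec.choose_spec

/-- Every element of `U°` has the form `P.incl f`, which forces the values of `β`. On such elements
colinearity of `β` reduces to that of `P.incl` and `σ P`. -/
lemma FinDual.existsUnique_desc (ρ : V →ₗ[K] BTensor K (FinDual K) V)
    (σ : ∀ P : NzOp K, Dual K P.M →ₗ[K] V)
    (hcol : ∀ P, IsColinear (FinDual.coact P.M) ρ (σ P))
    (hσ : ∀ (P Q : NzOp K) (h : P ≤ Q), σ Q ∘ₗ NzOp.trans h = σ P) :
    ∃! β : FinDual K →ₗ[K] V,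
      IsColinear Coring.comul ρ β ∧ ∀ P : NzOp K, β ∘ₗ P.incl = σ P := by
  have hd : ∀ P : NzOp K, FinDual.desc σ hσ ∘ₗ P.incl = σ P := fun P =>
    LinearMap.ext (FinDual.desc_incl σ hσ P)
  refine ⟨FinDual.desc σ hσ, ⟨fun z => ?_, hd⟩, ?_⟩
  · obtain ⟨P, f, rfl⟩ := z.exists_incl
    rw [FinDual.desc_incl, hcol, P.isColinear_incl, ← BTensor.map_comp_apply, hd]
  · rintro β ⟨-, hβ⟩
    refine LinearMap.ext fun z => ?_
    obtain ⟨P, f, rfl⟩ := z.exists_incl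
    rw [FinDual.desc_incl, ← hβ P]
    rfl

/-- The coaction on differentially recursive sequences in terms of an annihilating operator. -/
lemma coactTransport_finDualEquivDlin (α : Dlin K) (P : NzOp K)
    (hα : seqOp P.1 (α : ℕ → K) = 0) (b : Module.Basis (Fin P.1.degree) K P.M)
    (hb : ∀ i, b i = P.cl (DiffOp.Y ^ (i : ℕ))) :
    ∃ (a : Fin P.1.degree → FinDual K) (o : Fin P.1.degree → Dlin K),
      (∀ i, (finDualEquivDlin (a i) : ℕ → K) = shift^[(i : ℕ)] (α : ℕ → K)) ∧
      (∀ i n, (o i : ℕ → K) n = b.coord i (P.cl (DiffOp.Y ^ n))) ∧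
      coactTransport Coring.comul finDualEquivDlin α = ∑ i, btmul (a i) (o i) := by
  obtain ⟨f, hf⟩ := P.exists_toSeq_incl_eq hα
  have hα' : α = finDualEquivDlin.toLinearMap (P.incl f) := Subtype.ext hf.symm
  -- With `α` the sequence of `f`, the factors are those of the coaction on `f` in the basis `yᵢ`:
  -- `f ⊗ yᵢ` on the left, the sequence of `yᵢ^*` on the right.
  refine ⟨fun i => FinDual.mk P.M f (b i), fun i => finDualEquivDlin (P.incl (b.coord i)),
    fun i => funext fun n => ?_, fun i n => ?_, ?_⟩
  · change toSeq (FinDual.mk P.M f (b i)) n = _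
    rw [hb i, P.toSeq_mk_cl, shift_iterate, ← hf, P.toSeq_incl]
  · rw [coe_finDualEquivDlin, P.toSeq_incl]
  · rw [hα', isColinear_coactTransport, P.isColinear_incl, FinDual.coact_eq P.M b, map_sum,
      map_sum]
    rfl

end Coactions

end

end DiffRec

theorem proposition3 (K : Type u) [Field K] [Differential K] :
    -- the `M_P^*`, for nonzero `P`, form a directed system ...
    (Nonempty (NzOp K) ∧ IsDirectedOrder (NzOp K)) ∧
    DirectedSystem (fun P : NzOp K => Dual K P.M) (fun _ _ h => NzOp.trans h) ∧
    -- ... of left `U°`-comodules, the coaction being `f ↦ ∑ (f ⊗ yᵢ) ⊗ yᵢ^*` ...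
    (∀ P : NzOp K, IsLeftComodule (FinDual.coact P.M)) ∧
    (∀ P : NzOp K, ∃ b : Module.Basis (Fin P.1.degree) K P.M,
      (∀ i, b i = P.cl (DiffOp.Y ^ (i : ℕ))) ∧
      ∀ f : Dual K P.M, FinDual.coact P.M f = ∑ i, btmul (FinDual.mk P.M f (b i)) (b.coord i)) ∧
    -- ... with colinear transition maps
    (∀ (P Q : NzOp K) (h : P ≤ Q),
      IsColinear (FinDual.coact P.M) (FinDual.coact Q.M) (NzOp.trans h)) ∧
    -- `U°` is a left comodule over itself
    IsLeftComodule (Coring.comul : FinDual K →ₗ[K] BTensor K (FinDual K) (FinDual K)) ∧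
    -- the maps `f ↦ f ⊗ 1` are injective, colinear and compatible with the transition maps ...
    (∀ P : NzOp K, Function.Injective P.incl ∧
      IsColinear (FinDual.coact P.M) Coring.comul P.incl) ∧
    (∀ (P Q : NzOp K) (h : P ≤ Q), Q.incl ∘ₗ NzOp.trans h = P.incl) ∧
    -- ... and make `U°` the direct limit in the category of left `U°`-comodules
    (∀ (V : Type v) [AddCommGroup V] [Module K V] (ρ : V →ₗ[K] BTensor K (FinDual K) V),
      IsLeftComodule ρ →
      ∀ σ : ∀ P : NzOp K, Dual K P.M →ₗ[K] V,
        (∀ P, IsColinear (FinDual.coact P.M) ρ (σ P)) →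
        (∀ (P Q : NzOp K) (h : P ≤ Q), σ Q ∘ₗ NzOp.trans h = σ P) →
        ∃! β : FinDual K →ₗ[K] V,
          IsColinear Coring.comul ρ β ∧ ∀ P : NzOp K, β ∘ₗ P.incl = σ P) ∧
    -- `M_P^*` is the space of formal solutions of the equation attached to `P`
    (∀ P : NzOp K,
      (∀ (f : Dual K P.M) (n : ℕ), toSeq (P.incl f) n = f (P.cl (DiffOp.Y ^ n))) ∧
      Set.BijOn (fun f : Dual K P.M => toSeq (P.incl f)) Set.univ {α | seqOp P.1 α = 0}) ∧
    -- `U°` is isomorphic to the space of differentially recursive sequences, as a bimodule and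
    -- as a left comodule
    ∃ (e : FinDual K ≃ₗ[K] Dlin K) (ρ : Dlin K →ₗ[K] BTensor K (FinDual K) (Dlin K)),
      (∀ z : FinDual K, (e z : ℕ → K) = toSeq z) ∧
      (∀ (x : K) (z : FinDual K),
        (e (MulOpposite.op x • z) : ℕ → K) = hurwitz (e z : ℕ → K) (hurwitzExp x)) ∧
      IsLeftComodule ρ ∧
      IsColinear Coring.comul ρ e.toLinearMap ∧
      ∀ (α : Dlin K) (P : NzOp K), seqOp P.1 (α : ℕ → K) = 0 →
        ∀ b : Module.Basis (Fin P.1.degree) K P.M,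
          (∀ i, b i = P.cl (DiffOp.Y ^ (i : ℕ))) →
          ∃ (a : Fin P.1.degree → FinDual K) (o : Fin P.1.degree → Dlin K),
            (∀ i, (e (a i) : ℕ → K) = shift^[(i : ℕ)] (α : ℕ → K)) ∧
            (∀ i n, (o i : ℕ → K) n = b.coord i (P.cl (DiffOp.Y ^ n))) ∧
            ρ α = ∑ i, btmul (a i) (o i) := by
  refine ⟨⟨inferInstance, inferInstance⟩, NzOp.directedSystem_dual,
    fun P => FinDual.isLeftComodule_coact P.M,
    fun P => ⟨P.basis, P.basis_apply, FinDual.coact_eq P.M P.basis⟩,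
    fun _ _ h => NzOp.isColinear_trans h, FinDual.isLeftComodule_comul,
    fun P => ⟨P.incl_injective, P.isColinear_incl⟩, fun _ _ h => NzOp.incl_comp_trans h,
    fun V _ _ ρ _ σ hcol hσ => FinDual.existsUnique_desc ρ σ hcol hσ,
    fun P => ⟨P.toSeq_incl, fun f _ => P.seqOp_toSeq_incl f, P.toSeq_incl_injective.injOn,
      fun α hα => ?_⟩,
    finDualEquivDlin, coactTransport Coring.comul finDualEquivDlin, coe_finDualEquivDlin,
    toSeq_op_smul, FinDual.isLeftComodule_comul.transport _, isColinear_coactTransport _ _,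
    coactTransport_finDualEquivDlin⟩
  obtain ⟨f, hf⟩ := P.exists_toSeq_incl_eq hα
  exact ⟨f, trivial, hf⟩
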